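/- The chromatic symmetric function of a finite simple graph $G=(V,E)$ is the formal power series $$X_G=\sum_{\kappa}\prod_{v\in V}x_{\kappa(v)}$$ in commuting variables indexed by the natural numbers, where $\kappa$ runs over all proper colourings of $G$ with natural numbers as colours. A spider is a finite tree with exactly one vertex of degree at least three; this vertex is called the torso, and the paths that remain when the torso is removed are called the legs. A 2-spider is a tree obtained from a spider by choosing a (possibly empty) set of legs, each having at least two vertices, and attaching to each chosen leg one new vertex, joined to the second outermost vertex of that leg as seen from the torso (that is, to the neighbour of the leaf at the end of the leg). If $T_1$ and $T_2$ are non-isomorphic 2-spiders, then $X_{T_1}\neq X_{T_2}$. -/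

import Mathlib

/-- Stanley's chromatic symmetric function `X_G = ∑_κ ∏_{v ∈ V} x_{κ(v)}` of a finite graph, the sum
running over all proper colourings `κ : V → ℕ`, as a formal power series in the commuting variables
`x_0, x_1, x_2, …` with integer coefficients: the coefficient of the monomial `x ^ m` is the number
of proper colourings `κ` with `∏_v x_{κ(v)} = x ^ m`. -/
noncomputable def SimpleGraph.chromaticSymmetricFunction {V : Type*} [Fintype V]
    (G : SimpleGraph V) : MvPowerSeries ℕ ℤ :=
  fun m => (Nat.card {κ : G.Coloring ℕ // ∑ v, Finsupp.single (κ v) 1 = m} : ℤ)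

/-- The number of colourings in the definition of `chromaticSymmetricFunction` is finite, so that
`Nat.card` does count them. -/
theorem SimpleGraph.finite_coloring_of_content {V : Type*} [Fintype V] (G : SimpleGraph V)
    (m : ℕ →₀ ℕ) : Finite {κ : G.Coloring ℕ // ∑ v, Finsupp.single (κ v) 1 = m} := by
  classical
  have key : ∀ κ : {κ : G.Coloring ℕ // ∑ v, Finsupp.single (κ v) 1 = m}, ∀ v,
      κ.1 v ∈ m.support := by
    rintro ⟨κ, rfl⟩ v
    simp only [Finsupp.mem_support_iff, Finsupp.finsetSum_apply]
    intro h
    have := (Finset.sum_eq_zero_iff.mp h) v (Finset.mem_univ v)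
    simp at this
  refine Finite.of_injective (β := V → m.support) (fun κ v => ⟨κ.1 v, key κ v⟩) ?_
  intro κ κ' h
  apply Subtype.ext
  apply RelHom.ext
  intro v
  exact congrArg Subtype.val (congrFun h v)

open Classical in
/-- `G` is a spider with torso `t`: a tree in which `t` is the one and only vertex of degree at
least three. -/
def SimpleGraph.IsSpiderWithTorso {V : Type*} [Fintype V] (G : SimpleGraph V) (t : V) : Prop :=
  G.IsTree ∧ ∀ v, 3 ≤ G.degree v ↔ v = t

/-- For a graph `S` and a set `A` of vertices of `S`, the graph obtained by adding, for every
`a ∈ A`, one new vertex, joined exactly to the neighbours of `a` in `S`. If the elements of `A` are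
leaves, each new vertex is a pendant vertex attached to the unique neighbour of `a`. -/
def SimpleGraph.addTwins {V : Type*} (S : SimpleGraph V) (A : Set V) : SimpleGraph (V ⊕ A) where
  Adj
    | .inl v, .inl w => S.Adj v w
    | .inl v, .inr a => S.Adj v a
    | .inr a, .inl w => S.Adj a w
    | .inr _, .inr _ => False
  symm := ⟨by
    rintro (v | a) (w | b) h
    · exact SimpleGraph.Adj.symm h
    · exact SimpleGraph.Adj.symm h
    · exact SimpleGraph.Adj.symm h
    · exact h⟩
  loopless := ⟨by
    rintro (v | a) h
    · exact S.loopless.irrefl v h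
    · exact h⟩

open Classical in
/-- A 2-spider: a graph isomorphic to a spider `S` in which some legs carry one extra vertex joined
to the second outermost vertex of the leg. A leg of `S` (which does not contain the torso `t`) is
given by its outermost vertex, a leaf `a` of `S`; it has a second outermost vertex exactly if it has
at least two vertices, that is, if `a` is not adjacent to `t`, and this vertex is then the unique
neighbour of `a`. -/
def SimpleGraph.IsTwoSpider {V : Type*} (G : SimpleGraph V) : Prop :=
  ∃ (n : ℕ) (S : SimpleGraph (Fin n)) (t : Fin n) (A : Set (Fin n)),
    S.IsSpiderWithTorso t ∧ (∀ a ∈ A, S.degree a = 1 ∧ ¬ S.Adj t a) ∧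
      Nonempty (G ≃g S.addTwins A)

open Finset

/-! ### Distributions of a content -/

/-! Expanding $\prod_e (1-[\text{both ends of } e \text{ have the same colour}])$ writes $X_T$ as a
signed sum, over the sets of retained edges, of products of power sums $p_\lambda$, where the type
$\lambda$ lists the component sizes. In a tree the number of retained edges is $n$ minus the number
of components, so the sign depends on $\lambda$ alone and nothing cancels. The $p_\lambda$ are
linearly independent, hence $X_T$ determines how many edge sets have each type
(`ParentTree.sum_type_eq`).

A 2-spider amounts to a multiset of legs, each with a size (all its vertices, including an attached
one) and a mark for a fork. Let $N(x)$ count the legs with at least $x$ vertices, $u(x)$ those among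
them without fork, $k$ all legs and $f$ the forks. Three families of types suffice.

Two parts (one edge removed): these give $N(j)+N(n-j)$ up to corrections by $f$, and in particular
the number $k+f$ of leaves.

$n-2$ parts, one of them of size 3 (two adjacent edges retained): together with $k+f$ this yields
$k^2-5k$, hence $k$ because $k\ge 3$, and then $f$. Now $N$ follows from its symmetric sums, since
two long legs do not fit beside a third (`eq_of_symmetric_sums_eq`).

Three parts $2,b,c$: once $N$ is known, these give $u(b+2)+u(c+2)-u(b)-u(c)$. This recurrence, the
small values of $u$, and the fact that $N=1$ on the stretch where only the longest leg remains,
determine $u$ (`eq_of_recurrence`). -/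

theorem exists_equiv_of_card_fiber_eq {α β γ : Type*} [Fintype α] [Fintype β] [DecidableEq γ]
    (s : α → γ) (t : β → γ) (h : ∀ c, #{x | s x = c} = #{y | t y = c}) :
    ∃ e : α ≃ β, ∀ x, t (e x) = s x := by
  have hc : ∀ c, Nonempty ({x // s x = c} ≃ {y // t y = c}) := fun c =>
    ⟨Fintype.equivOfCardEq (by rw [Fintype.card_subtype, Fintype.card_subtype, h])⟩
  exact ⟨Equiv.ofFiberEquiv fun c => (hc c).some, fun x => Equiv.ofFiberEquiv_map _ x⟩

theorem exists_equiv_of_map_univ_eq {α β γ : Type*} [Fintype α] [Fintype β] (s : α → γ)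
    (t : β → γ) (h : univ.val.map s = univ.val.map t) : ∃ e : α ≃ β, ∀ x, t (e x) = s x := by
  classical
  refine exists_equiv_of_card_fiber_eq s t fun c => ?_
  have := congrArg (Multiset.count c) h
  rw [Multiset.count_map, Multiset.count_map] at this
  rw [card_def, card_def, filter_val, filter_val]
  simpa only [eq_comm] using this

/-- The number of maps `f : α → ℕ` that collect the weights `s` to the content `m`; the coefficient
of `x ^ m` in the product of the power sums `p_{s x}`. -/
noncomputable def fillings {α : Type*} [Fintype α] (s : α → ℕ) (m : ℕ →₀ ℕ) : ℕ :=
  Nat.card {f : α → ℕ // ∑ x, Finsupp.single (f x) (s x) = m}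

theorem fillings_congr {α β : Type*} [Fintype α] [Fintype β] {s : α → ℕ} {t : β → ℕ}
    (h : univ.val.map s = univ.val.map t) (m : ℕ →₀ ℕ) : fillings s m = fillings t m := by
  obtain ⟨e, he⟩ := exists_equiv_of_map_univ_eq s t h
  refine Nat.card_congr ((e.arrowCongr (Equiv.refl ℕ)).subtypeEquiv fun f => ?_)
  rw [← e.sum_comp]
  simp [he]

theorem finite_fillings {α : Type*} [Fintype α] (s : α → ℕ) (hs : ∀ x, s x ≠ 0) (m : ℕ →₀ ℕ) :
    Finite {f : α → ℕ // ∑ x, Finsupp.single (f x) (s x) = m} := by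
  classical
  have key : ∀ f : {f : α → ℕ // ∑ x, Finsupp.single (f x) (s x) = m}, ∀ x,
      f.1 x ∈ m.support := by
    rintro ⟨f, rfl⟩ x
    simp only [Finsupp.mem_support_iff, Finsupp.finsetSum_apply]
    intro h
    have := (Finset.sum_eq_zero_iff.mp h) x (Finset.mem_univ x)
    simp [hs] at this
  refine Finite.of_injective (β := α → m.support) (fun f x => ⟨f.1 x, key f x⟩) ?_
  intro f f' h
  apply Subtype.ext
  funext x
  exact congrArg Subtype.val (congrFun h x)

theorem map_support_sum_single {α : Type*} [Fintype α] (s f : α → ℕ) (hs : ∀ x, s x ≠ 0)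
    (hf : Function.Injective f) {m : ℕ →₀ ℕ} (hm : ∑ x, Finsupp.single (f x) (s x) = m) :
    m.support.val.map m = univ.val.map s := by
  classical
  subst hm
  have hval : ∀ y, (∑ x, Finsupp.single (f x) (s x)) (f y) = s y := fun y => by
    rw [Finsupp.finsetSum_apply, Finset.sum_eq_single y]
    · simp
    · intro x _ hx
      exact Finsupp.single_eq_of_ne fun h => hx (hf h).symm
    · simp
  have hsupp : (∑ x, Finsupp.single (f x) (s x)).support = univ.map ⟨f, hf⟩ := by
    ext c
    rw [Finsupp.mem_support_iff]
    constructor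
    · intro h
      rw [Finsupp.finsetSum_apply] at h
      obtain ⟨x, -, hx⟩ := Finset.exists_ne_zero_of_sum_ne_zero h
      rw [mem_map]
      refine ⟨x, mem_univ _, ?_⟩
      by_contra hne
      exact hx (Finsupp.single_eq_of_ne fun h' => hne h'.symm)
    · intro h
      obtain ⟨x, -, rfl⟩ := mem_map.1 h
      exact (hval x).symm ▸ hs x
  rw [hsupp, map_val, Multiset.map_map]
  exact Multiset.map_congr rfl fun x _ => hval x

/-- With at least as many colours used as there are weights, no two weights share a colour, so the
exponents are the weights themselves. -/
theorem map_support_eq_of_card_le {α : Type*} [Fintype α] (s : α → ℕ) (hs : ∀ x, s x ≠ 0)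
    {m : ℕ →₀ ℕ} (h : fillings s m ≠ 0) (hm : Fintype.card α ≤ #m.support) :
    m.support.val.map m = univ.val.map s := by
  classical
  obtain ⟨⟨f, rfl⟩⟩ : Nonempty {f : α → ℕ // ∑ x, Finsupp.single (f x) (s x) = m} := by
    by_contra hne
    rw [not_nonempty_iff] at hne
    exact h Nat.card_of_isEmpty
  refine map_support_sum_single s f hs ?_ rfl
  have hsub : (∑ x, Finsupp.single (f x) (s x)).support ⊆ univ.image f := by
    intro c hc
    rw [Finsupp.mem_support_iff, Finsupp.finsetSum_apply] at hc
    obtain ⟨x, -, hx⟩ := Finset.exists_ne_zero_of_sum_ne_zero hc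
    rw [mem_image]
    refine ⟨x, mem_univ _, ?_⟩
    by_contra hne
    exact hx (Finsupp.single_eq_of_ne fun h' => hne h'.symm)
  have h1 := card_le_card hsub
  have h2 : #(univ.image f) ≤ Fintype.card α := card_image_le
  have h3 : #(univ.image f) = #(univ : Finset α) := by rw [card_univ]; omega
  exact fun x y hxy => card_image_iff.1 h3 (mem_coe.2 (mem_univ x)) (mem_coe.2 (mem_univ y)) hxy

/-- The products of power sums over different multisets of positive integers are linearly
independent. -/
theorem eq_zero_of_sum_fillings_eq_zero (L : Finset (Multiset ℕ)) (hL : ∀ l ∈ L, 0 ∉ l)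
    (a : Multiset ℕ → ℤ)
    (h : ∀ m, ∑ l ∈ L, a l * fillings (fun x : l.ToType => (x : ℕ)) m = 0) :
    ∀ l ∈ L, a l = 0 := by
  classical
  by_contra! hne
  obtain ⟨l₀, hl₀, ha₀⟩ := hne
  -- A longest multiset with nonzero coefficient: the monomial that gives its parts distinct colours
  -- occurs in no other product with at most as many factors.
  obtain ⟨l, hl, hmax⟩ := (L.filter fun l => a l ≠ 0).exists_max_image Multiset.card
    ⟨l₀, mem_filter.2 ⟨hl₀, ha₀⟩⟩
  rw [mem_filter] at hl
  have hpos : ∀ l ∈ L, ∀ x : l.ToType, (x : ℕ) ≠ 0 := fun l hl x hx => by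
    refine hL l hl ?_
    have := Multiset.coe_mem (x := x)
    rwa [hx] at this
  let f : l.ToType → ℕ := fun x => (Fintype.equivFin l.ToType x : ℕ)
  have hf : Function.Injective f := fun x y hxy =>
    (Fintype.equivFin l.ToType).injective (Fin.ext hxy)
  set m : ℕ →₀ ℕ := ∑ x : l.ToType, Finsupp.single (f x) (x : ℕ) with hm
  have hml : m.support.val.map m = l := by
    rw [map_support_sum_single (fun x : l.ToType => (x : ℕ)) f (hpos l hl.1) hf hm.symm]
    exact Multiset.map_univ_coe l
  have hcard : #m.support = Multiset.card l := by
    rw [card_def, ← Multiset.card_map m, hml]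
  have hsum := h m
  rw [Finset.sum_eq_single_of_mem l hl.1] at hsum
  · have : fillings (fun x : l.ToType => (x : ℕ)) m ≠ 0 := by
      have := finite_fillings (fun x : l.ToType => (x : ℕ)) (hpos l hl.1) m
      rw [fillings, Nat.card_ne_zero]
      exact ⟨⟨⟨f, rfl⟩⟩, this⟩
    have h' : ((fillings (fun x : l.ToType => (x : ℕ)) m : ℕ) : ℤ) ≠ 0 := by exact_mod_cast this
    exact (mul_ne_zero hl.2 h') hsum
  · intro l' hl' hne
    by_cases ha : a l' = 0
    · simp [ha]
    by_cases hfil : fillings (fun x : l'.ToType => (x : ℕ)) m = 0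
    · simp [hfil]
    exfalso
    have hle := hmax l' (mem_filter.2 ⟨hl', ha⟩)
    have := map_support_eq_of_card_le (fun x : l'.ToType => (x : ℕ)) (hpos l' hl') hfil
      (by rw [hcard, Multiset.card_coe]; exact hle)
    rw [hml, Multiset.map_univ_coe] at this
    exact hne this.symm

/-! ### Trees given by a parent function -/

/-- A tree on `V` given by a root and a parent function, whose iterates lead to the root. -/
structure ParentTree (V : Type*) where
  root : V
  parent : V → V
  rank : V → ℕ
  rank_parent_lt : ∀ v, v ≠ root → rank (parent v) < rank v

namespace ParentTree

variable {V : Type*}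

/-- The graph in which every vertex other than the root is joined to its parent. -/
def graph (P : ParentTree V) : SimpleGraph V where
  Adj v w := (v ≠ P.root ∧ P.parent v = w) ∨ (w ≠ P.root ∧ P.parent w = v)
  symm := ⟨fun _ _ h => h.symm⟩
  loopless := ⟨fun v h => by
    have h' : v ≠ P.root ∧ P.parent v = v := h.elim id id
    have := P.rank_parent_lt v h'.1
    rw [h'.2] at this
    exact lt_irrefl _ this⟩

/-- The content of an injective colouring occurs in the series, and its degree is the number of
vertices. -/
theorem card_eq_of_chromaticSymmetricFunction_eq {W : Type*} [Fintype V] [Fintype W] (P : ParentTree V)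
    (G : SimpleGraph W)
    (h : P.graph.chromaticSymmetricFunction = G.chromaticSymmetricFunction) :
    Fintype.card V = Fintype.card W := by
  classical
  let κ₀ : P.graph.Coloring ℕ := SimpleGraph.Coloring.mk
    (fun v => (Fintype.equivFin V v : ℕ)) fun {v w} hvw heq =>
      hvw.ne ((Fintype.equivFin V).injective (Fin.ext heq))
  set m : ℕ →₀ ℕ := ∑ v, Finsupp.single (κ₀ v) 1 with hm
  have hV : Nat.card {κ : P.graph.Coloring ℕ // ∑ v, Finsupp.single (κ v) 1 = m} ≠ 0 := by
    rw [Nat.card_ne_zero]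
    exact ⟨⟨⟨κ₀, rfl⟩⟩, P.graph.finite_coloring_of_content m⟩
  have hW : Nat.card {κ : G.Coloring ℕ // ∑ v, Finsupp.single (κ v) 1 = m} ≠ 0 := by
    have := congrFun h m
    unfold SimpleGraph.chromaticSymmetricFunction at this
    rwa [← Nat.cast_injective this]
  obtain ⟨⟨κ₁, h₁⟩⟩ := (Nat.card_ne_zero.1 hW).1
  have hdeg := congrArg Finsupp.degree (hm.symm.trans h₁.symm)
  simpa [map_sum] using hdeg

/-! ### Power-sum expansion of a tree -/

section Cut

variable [DecidableEq V]

/-- The topmost vertex of the component of a vertex, after the edges from the vertices in `C` to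
their parents have been removed. -/
def top (P : ParentTree V) (C : Finset V) (v : V) : V :=
  if _h : v = P.root ∨ v ∈ C then v else P.top C (P.parent v)
termination_by P.rank v
decreasing_by exact P.rank_parent_lt v fun h' => _h (Or.inl h')

theorem top_of_mem (P : ParentTree V) {C : Finset V} {v : V} (hv : v ∈ C) : P.top C v = v := by
  rw [top, dif_pos (Or.inr hv)]

theorem top_of_notMem (P : ParentTree V) {C : Finset V} (hC : P.root ∈ C) {v : V} (hv : v ∉ C) :
    P.top C v = P.top C (P.parent v) := by
  rw [top, dif_neg]
  rintro (rfl | h)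
  exacts [hv hC, hv h]

theorem parent_induction (P : ParentTree V) {C : Finset V} (hC : P.root ∈ C) {p : V → Prop}
    (hmem : ∀ v ∈ C, p v) (hstep : ∀ v ∉ C, p (P.parent v) → p v) (v : V) : p v := by
  induction hn : P.rank v using Nat.strong_induction_on generalizing v with
  | _ n ih =>
    by_cases hv : v ∈ C
    · exact hmem v hv
    · refine hstep v hv (ih _ ?_ _ rfl)
      rw [← hn]
      exact P.rank_parent_lt v fun h => hv (h ▸ hC)

theorem top_mem (P : ParentTree V) {C : Finset V} (hC : P.root ∈ C) (v : V) : P.top C v ∈ C := by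
  refine P.parent_induction (p := fun v => P.top C v ∈ C) hC (fun v hv => ?_)
    (fun v hv ih => ?_) v
  · rwa [P.top_of_mem hv]
  · rwa [P.top_of_notMem hC hv]

theorem eq_comp_top_iff (P : ParentTree V) {C : Finset V} (hC : P.root ∈ C) {γ : Type*}
    (κ : V → γ) : (∀ v ∉ C, κ v = κ (P.parent v)) ↔ ∀ v, κ v = κ (P.top C v) := by
  constructor
  · intro h v
    refine P.parent_induction (p := fun v => κ v = κ (P.top C v)) hC (fun v hv => ?_)
      (fun v hv ih => ?_) v
    · rw [P.top_of_mem hv]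
    · rw [P.top_of_notMem hC hv, h v hv, ih]
  · intro h v hv
    rw [h v, h (P.parent v), P.top_of_notMem hC hv]

variable [Fintype V]

/-- The size of the component with topmost vertex `x`, after the edges above `C` are removed. -/
def size (P : ParentTree V) (C : Finset V) (x : V) : ℕ := #{v | P.top C v = x}

/-- The multiset of the component sizes, after the edges above `C` are removed. -/
def type (P : ParentTree V) (C : Finset V) : Multiset ℕ := C.val.map (P.size C)

/-- The sets `C` that contain the root. -/
def cuts (P : ParentTree V) : Finset (Finset V) := {C | P.root ∈ C}

theorem mem_cuts (P : ParentTree V) {C : Finset V} : C ∈ P.cuts ↔ P.root ∈ C := by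
  simp [cuts]

theorem size_ne_zero (P : ParentTree V) {C : Finset V} {x : V} (hx : x ∈ C) : P.size C x ≠ 0 :=
  card_ne_zero_of_mem (mem_filter.2 ⟨mem_univ _, P.top_of_mem hx⟩)

theorem card_type (P : ParentTree V) (C : Finset V) : Multiset.card (P.type C) = #C := by
  simp [type]

theorem zero_notMem_type (P : ParentTree V) (C : Finset V) : 0 ∉ P.type C := by
  simp only [type, Multiset.mem_map, not_exists, not_and]
  exact fun x hx h => P.size_ne_zero hx h

theorem sum_single_comp_top (P : ParentTree V) {C : Finset V} (hC : P.root ∈ C) (f : V → ℕ) :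
    ∑ v, Finsupp.single (f (P.top C v)) 1 = ∑ x : C, Finsupp.single (f x) (P.size C x) := by
  rw [Finset.sum_coe_sort C fun x => Finsupp.single (f x) (P.size C x)]
  rw [← Finset.sum_fiberwise_of_maps_to (t := C) (g := P.top C) fun v _ => P.top_mem hC v]
  refine sum_congr rfl fun x _ => ?_
  rw [Finset.sum_congr rfl (g := fun _ => Finsupp.single (f x) 1)
    fun v hv => by rw [(mem_filter.1 hv).2], sum_const, Finsupp.smul_single, smul_eq_mul, mul_one]
  rfl

/-- A colouring that is constant along the retained edges is a free choice of one colour per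
component, which then counts with the size of the component. -/
theorem card_constant_colorings (P : ParentTree V) {C : Finset V} (hC : P.root ∈ C)
    (m : ℕ →₀ ℕ) :
    Nat.card {κ : V → ℕ // ∑ v, Finsupp.single (κ v) 1 = m ∧ ∀ v ∉ C, κ v = κ (P.parent v)} =
      fillings (fun x : C => P.size C x) m := by
  refine Nat.card_congr
    { toFun := fun κ => ⟨fun x => κ.1 x, ?_⟩
      invFun := fun f => ⟨fun v => f.1 ⟨P.top C v, P.top_mem hC v⟩, ?_, ?_⟩
      left_inv := ?_
      right_inv := ?_ }
  · rw [← P.sum_single_comp_top hC]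
    refine Eq.trans ?_ κ.2.1
    exact sum_congr rfl fun v _ => by rw [← (P.eq_comp_top_iff hC κ.1).1 κ.2.2 v]
  · let f' : V → ℕ := fun v => if h : v ∈ C then f.1 ⟨v, h⟩ else 0
    have h1 : ∀ v, f.1 ⟨P.top C v, P.top_mem hC v⟩ = f' (P.top C v) := fun v => by
      simp [f', P.top_mem hC v]
    simp only [h1]
    rw [P.sum_single_comp_top hC]
    refine Eq.trans ?_ f.2
    exact sum_congr rfl fun x _ => by simp [f']
  · intro v hv
    simp only [P.top_of_notMem hC hv]
  · rintro ⟨κ, h1, h2⟩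
    apply Subtype.ext
    funext v
    exact ((P.eq_comp_top_iff hC κ).1 h2 v).symm
  · rintro ⟨f, hf⟩
    apply Subtype.ext
    funext x
    simp only
    congr 1
    exact Subtype.ext (P.top_of_mem x.2)

/-- Inclusion–exclusion over the edges; an edge is named by its lower end, and `C` consists of the
topmost vertices of the components. -/
theorem chromaticSymmetricFunction_graph (P : ParentTree V) (m : ℕ →₀ ℕ) :
    P.graph.chromaticSymmetricFunction m =
      ∑ C ∈ P.cuts, (-1) ^ (Fintype.card V - #C) *
        (fillings (fun x : C => P.size C x) m : ℤ) := by
  classical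
  have hfin : {κ : V → ℕ | ∑ v, Finsupp.single (κ v) 1 = m}.Finite :=
    finite_fillings (fun _ : V => 1) (fun _ => one_ne_zero) m
  set Φ := hfin.toFinset with hΦ
  have hmem : ∀ κ, κ ∈ Φ ↔ ∑ v, Finsupp.single (κ v) 1 = m := fun κ => by simp [hΦ]
  have hX : P.graph.chromaticSymmetricFunction m =
      ∑ κ ∈ Φ, ∏ v ∈ univ.erase P.root, (1 + -(if κ v = κ (P.parent v) then 1 else 0) : ℤ) := by
    have h1 : ∀ κ : V → ℕ, ∏ v ∈ univ.erase P.root,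
        (1 + -(if κ v = κ (P.parent v) then 1 else 0) : ℤ) =
          if ∀ v, v ≠ P.root → κ v ≠ κ (P.parent v) then 1 else 0 := fun κ => by
      split_ifs with h
      · exact prod_eq_one fun v hv => by simp [h v (ne_of_mem_erase hv)]
      · push Not at h
        obtain ⟨v, hv, hv'⟩ := h
        exact prod_eq_zero (mem_erase.2 ⟨hv, mem_univ v⟩) (by simp [hv'])
    simp only [h1]
    rw [← Finset.sum_filter, sum_const, nsmul_eq_mul, mul_one]
    have h2 : Nat.card {κ : P.graph.Coloring ℕ // ∑ v, Finsupp.single (κ v) 1 = m} =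
        #(Φ.filter fun κ => ∀ v, v ≠ P.root → κ v ≠ κ (P.parent v)) := by
      rw [← Nat.card_eq_finsetCard]
      refine Nat.card_congr
        { toFun := fun κ => ⟨κ.1, mem_filter.2 ⟨(hmem _).2 κ.2, fun v hv => ?_⟩⟩
          invFun := fun κ => ⟨SimpleGraph.Coloring.mk κ.1 ?_, (hmem _).1 (mem_filter.1 κ.2).1⟩
          left_inv := fun κ => rfl
          right_inv := fun κ => rfl }
      · exact κ.1.valid (Or.inl ⟨hv, rfl⟩)
      · rintro v w (⟨h, rfl⟩ | ⟨h, rfl⟩)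
        · exact (mem_filter.1 κ.2).2 v h
        · exact ((mem_filter.1 κ.2).2 w h).symm
    unfold SimpleGraph.chromaticSymmetricFunction
    exact_mod_cast h2
  rw [hX]
  simp only [prod_add, prod_const_one, one_mul]
  rw [sum_comm]
  -- `t` holds the vertices whose factor contributes the summand 1, that is, whose edge to the
  -- parent is removed.
  refine sum_bij' (fun t _ => insert P.root t) (fun C _ => C.erase P.root) ?_ ?_ ?_ ?_ ?_
  · exact fun t _ => P.mem_cuts.2 (mem_insert_self _ _)
  · exact fun C _ => mem_powerset.2 (erase_subset_erase _ (subset_univ C))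
  · exact fun t ht => erase_insert fun h => notMem_erase _ _ (mem_powerset.1 ht h)
  · exact fun C hC => insert_erase (P.mem_cuts.1 hC)
  intro t ht
  have hroot : P.root ∉ t := fun h => notMem_erase _ _ (mem_powerset.1 ht h)
  have hcompl : univ.erase P.root \ t = univ \ insert P.root t := by
    ext v
    simp only [mem_sdiff, mem_erase, mem_univ, and_true, mem_insert, true_and, not_or]
  have hprod : ∀ κ : V → ℕ, ∏ v ∈ univ.erase P.root \ t,
      (-(if κ v = κ (P.parent v) then 1 else 0) : ℤ) =
        (-1) ^ (Fintype.card V - #(insert P.root t)) *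
          if ∀ v ∉ insert P.root t, κ v = κ (P.parent v) then 1 else 0 := fun κ => by
    rw [prod_neg, hcompl, card_sdiff_of_subset (subset_univ _), card_univ]
    congr 1
    split_ifs with h
    · exact prod_eq_one fun v hv => if_pos (h v (mem_sdiff.1 hv).2)
    · push Not at h
      obtain ⟨v, hv, hv'⟩ := h
      exact prod_eq_zero (mem_sdiff.2 ⟨mem_univ v, hv⟩) (if_neg hv')
  simp only [hprod]
  rw [← mul_sum, ← Finset.sum_filter, sum_const, nsmul_eq_mul, mul_one,
    ← P.card_constant_colorings (mem_insert_self _ _),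
    ← Nat.card_eq_finsetCard (filter _ _)]
  refine congrArg (fun z : ℕ => (-1 : ℤ) ^ (Fintype.card V - #(insert P.root t)) * z)
    (Nat.card_congr (Equiv.subtypeEquivRight (α := V → ℕ) fun κ => ?_))
  rw [mem_filter, hmem]

/-- The sign depends only on the number of parts, so edge sets of the same type reinforce each
other. -/
theorem chromaticSymmetricFunction_graph_eq_sum_type (P : ParentTree V) (L : Finset (Multiset ℕ))
    (hL : ∀ C ∈ P.cuts, P.type C ∈ L) (m : ℕ →₀ ℕ) :
    P.graph.chromaticSymmetricFunction m =
      ∑ l ∈ L, #{C ∈ P.cuts | P.type C = l} *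
        ((-1) ^ (Fintype.card V - Multiset.card l) *
          (fillings (fun x : l.ToType => (x : ℕ)) m : ℤ)) := by
  classical
  rw [chromaticSymmetricFunction_graph, ← Finset.sum_fiberwise_of_maps_to (t := L) hL]
  refine sum_congr rfl fun l _ => ?_
  rw [← nsmul_eq_mul, ← sum_const]
  refine sum_congr rfl fun C hC => ?_
  obtain ⟨-, rfl⟩ := mem_filter.1 hC
  rw [card_type]
  congr 2
  refine fillings_congr ?_ m
  rw [Multiset.map_univ_coe]
  change Multiset.map (fun x : C => P.size C x) C.val.attach = _
  exact Multiset.attach_map_val' C.val (P.size C)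

/-- The chromatic symmetric function of a tree determines how often every type of partition into
connected parts occurs. -/
theorem sum_type_eq {W : Type*} [Fintype W] [DecidableEq W] (P : ParentTree V) (Q : ParentTree W)
    (h : P.graph.chromaticSymmetricFunction = Q.graph.chromaticSymmetricFunction)
    (g : Multiset ℕ → ℤ) :
    ∑ C ∈ P.cuts, g (P.type C) = ∑ C ∈ Q.cuts, g (Q.type C) := by
  classical
  set L := P.cuts.image P.type ∪ Q.cuts.image Q.type with hL
  have hP : ∀ C ∈ P.cuts, P.type C ∈ L := fun C hC =>
    mem_union_left _ (mem_image_of_mem _ hC)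
  have hQ : ∀ C ∈ Q.cuts, Q.type C ∈ L := fun C hC =>
    mem_union_right _ (mem_image_of_mem _ hC)
  have hcard := P.card_eq_of_chromaticSymmetricFunction_eq Q.graph h
  have key := eq_zero_of_sum_fillings_eq_zero L ?_
    (fun l => ((#{C ∈ P.cuts | P.type C = l} : ℤ) - #{C ∈ Q.cuts | Q.type C = l}) *
      (-1) ^ (Fintype.card V - Multiset.card l)) ?_
  · rw [← Finset.sum_fiberwise_of_maps_to (t := L) hP,
      ← Finset.sum_fiberwise_of_maps_to (t := L) hQ]
    refine sum_congr rfl fun l hl => ?_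
    have hl' := key l hl
    rw [mul_eq_zero_iff_right (by simp), sub_eq_zero] at hl'
    rw [sum_congr rfl (g := fun _ => g l) fun C hC => by rw [(mem_filter.1 hC).2],
      sum_congr rfl (s₁ := {C ∈ Q.cuts | Q.type C = l}) (g := fun _ => g l)
        fun C hC => by rw [(mem_filter.1 hC).2], sum_const, sum_const, nsmul_eq_mul, nsmul_eq_mul,
      hl']
  · intro l hl
    rcases mem_union.1 hl with hl | hl <;> obtain ⟨C, -, rfl⟩ := mem_image.1 hl
    exacts [P.zero_notMem_type C, Q.zero_notMem_type C]
  · intro m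
    have hm := congrFun h m
    rw [P.chromaticSymmetricFunction_graph_eq_sum_type L hP,
      Q.chromaticSymmetricFunction_graph_eq_sum_type L hQ, ← hcard, ← sub_eq_zero,
      ← sum_sub_distrib] at hm
    rw [← hm]
    exact sum_congr rfl fun l _ => by ring

end Cut
end ParentTree

/-! ### Types with few removed or few retained edges -/

namespace ParentTree

variable {V : Type*}

/-- `P.Below v u` says that `v` is on the way from `u` to the root. -/
inductive Below (P : ParentTree V) (v : V) : V → Prop
  | refl : Below P v v
  | step (u : V) : u ≠ P.root → Below P v (P.parent u) → Below P v u

theorem below_iff_below_parent (P : ParentTree V) {v u : V} (hu : u ≠ P.root) (huv : u ≠ v) :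
    P.Below v u ↔ P.Below v (P.parent u) := by
  refine ⟨fun h => ?_, Below.step u hu⟩
  cases h with
  | refl => exact absurd rfl huv
  | step _ _ h => exact h

theorem not_below_root (P : ParentTree V) {v : V} (hv : v ≠ P.root) : ¬ P.Below v P.root := by
  intro h
  cases h with
  | refl => exact hv rfl
  | step _ h _ => exact h rfl

theorem Below.trans {P : ParentTree V} {v w u : V} (h : P.Below v w) (h' : P.Below w u) :
    P.Below v u := by
  induction h' with
  | refl => exact h
  | step u hu _ ih => exact .step u hu ih

theorem Below.total {P : ParentTree V} {v w u : V} (h : P.Below v u) (h' : P.Below w u) :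
    P.Below v w ∨ P.Below w v := by
  induction h with
  | refl => exact Or.inr h'
  | step u hu h ih =>
    cases h' with
    | refl => exact Or.inl (.step _ hu h)
    | step _ _ h' => exact ih h'

theorem Below.eq_or_rank_lt {P : ParentTree V} {v u : V} (h : P.Below v u) :
    u = v ∨ P.rank v < P.rank u := by
  induction h with
  | refl => exact Or.inl rfl
  | step u hu _ ih =>
    have := P.rank_parent_lt u hu
    rcases ih with ih | ih
    · rw [ih] at this
      exact Or.inr this
    · exact Or.inr (ih.trans this)

theorem Below.antisymm {P : ParentTree V} {v w : V} (h : P.Below v w) (h' : P.Below w v) :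
    v = w := by
  rcases h.eq_or_rank_lt with h | h
  · exact h.symm
  · rcases h'.eq_or_rank_lt with h' | h'
    · exact h'
    · omega

theorem parent_ne_self (P : ParentTree V) {v : V} (hv : v ≠ P.root) : P.parent v ≠ v := fun h => by
  have := P.rank_parent_lt v hv
  rw [h] at this
  exact lt_irrefl _ this

variable [DecidableEq V]

theorem top_eq (P : ParentTree V) {C : Finset V} (hC : P.root ∈ C) (t : V → V)
    (h1 : ∀ v ∈ C, t v = v) (h2 : ∀ v ∉ C, t v = t (P.parent v)) : P.top C = t := by
  funext v
  refine P.parent_induction (p := fun v => P.top C v = t v) hC (fun v hv => ?_)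
    (fun v hv ih => ?_) v
  · rw [P.top_of_mem hv, h1 v hv]
  · rw [P.top_of_notMem hC hv, h2 v hv, ih]

variable [Fintype V]

open Classical in
/-- The number of vertices of the subtree at `v`. -/
noncomputable def sub (P : ParentTree V) (v : V) : ℕ := #{u | P.Below v u}

theorem card_three_eq_add {V : Type*} [Fintype V] (a b : V → Prop) [DecidablePred a]
    [DecidablePred b] : Fintype.card V = #{u | a u} + (#{u | b u ∧ ¬ a u} + #{u | ¬ a u ∧ ¬ b u}) := by
  rw [← card_univ, ← card_filter_add_card_filter_not (s := univ) a]
  congr 1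
  rw [← card_filter_add_card_filter_not (s := filter (fun u => ¬ a u) univ) b, filter_filter,
    filter_filter]
  simp only [and_comm]

theorem type_pair (P : ParentTree V) {v : V} (hv : v ≠ P.root) :
    P.sub v < Fintype.card V ∧
    P.type {P.root, v} = {Fintype.card V - P.sub v, P.sub v} := by
  classical
  have htop : P.top {P.root, v} = fun u => if P.Below v u then v else P.root := by
    refine P.top_eq (by simp) _ ?_ ?_
    · intro u hu
      rcases mem_insert.1 hu with rfl | hu
      · exact if_neg (P.not_below_root hv)
      · rw [mem_singleton.1 hu]
        exact if_pos .refl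
    · intro u hu
      simp only [mem_insert, mem_singleton, not_or] at hu
      simp only [P.below_iff_below_parent hu.1 hu.2]
  have h1 : P.size {P.root, v} v = P.sub v := by
    unfold size sub
    congr 1
    ext u
    simp only [mem_filter, mem_univ, true_and, htop]
    split_ifs with h <;> simp [h, hv.symm]
  have h2 : P.size {P.root, v} P.root = #{u | ¬ P.Below v u} := by
    unfold size
    congr 1
    ext u
    simp only [mem_filter, mem_univ, true_and, htop]
    split_ifs with h <;> simp [h, hv]
  have h3 : P.sub v + #{u | ¬ P.Below v u} = Fintype.card V := by
    unfold sub
    rw [card_filter_add_card_filter_not, card_univ]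
  have h4 := P.size_ne_zero (C := {P.root, v}) (mem_insert_self P.root _)
  refine ⟨by omega, ?_⟩
  rw [type, insert_val_of_notMem (by simpa using hv.symm), Multiset.map_cons, singleton_val,
    Multiset.map_singleton, h1, h2, show #{u | ¬ P.Below v u} = Fintype.card V - P.sub v by omega]
  rfl

/-- Since `w` is not an ancestor of `v`, the whole subtree at `w` is one component; the component of
`v` is its subtree, minus that of `w` if `v` is an ancestor of `w`. -/
theorem type_triple (P : ParentTree V) {v w : V} (hv : v ≠ P.root) (hw : w ≠ P.root)
    (hwv : ¬ P.Below w v) :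
    ∃ x y, P.type {P.root, v, w} = {x, y, P.sub w} ∧ x + y + P.sub w = Fintype.card V ∧
      (P.Below v w → y + P.sub w = P.sub v) ∧ (¬ P.Below v w → y = P.sub v) := by
  classical
  have hne : v ≠ w := fun h => hwv (h ▸ .refl)
  have htop : P.top {P.root, v, w} =
      fun u => if P.Below w u then w else if P.Below v u then v else P.root := by
    refine P.top_eq (by simp) _ ?_ ?_
    · intro u hu
      simp only [mem_insert, mem_singleton] at hu
      rcases hu with rfl | rfl | rfl
      · rw [if_neg (P.not_below_root hw), if_neg (P.not_below_root hv)]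
      · rw [if_neg hwv, if_pos .refl]
      · exact if_pos .refl
    · intro u hu
      simp only [mem_insert, mem_singleton, not_or] at hu
      simp only [P.below_iff_below_parent hu.1 hu.2.1, P.below_iff_below_parent hu.1 hu.2.2]
  have h1 : P.size {P.root, v, w} w = P.sub w := by
    unfold size sub
    congr 1
    ext u
    simp only [mem_filter, mem_univ, true_and, htop]
    by_cases h : P.Below w u <;> by_cases h' : P.Below v u <;> simp [h, h', hw.symm, hne]
  have h2 : P.size {P.root, v, w} v = #{u | P.Below v u ∧ ¬ P.Below w u} := by
    unfold size
    congr 1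
    ext u
    simp only [mem_filter, mem_univ, true_and, htop]
    by_cases h : P.Below w u <;> by_cases h' : P.Below v u <;> simp [h, h', hne.symm, hv.symm]
  have h3 : P.size {P.root, v, w} P.root = #{u | ¬ P.Below w u ∧ ¬ P.Below v u} := by
    unfold size
    congr 1
    ext u
    simp only [mem_filter, mem_univ, true_and, htop]
    by_cases h : P.Below w u <;> by_cases h' : P.Below v u <;> simp [h, h', hv, hw]
  refine ⟨P.size {P.root, v, w} P.root, P.size {P.root, v, w} v, ?_, ?_, ?_, ?_⟩
  · rw [type, insert_val_of_notMem (by simp [hv.symm, hw.symm]), Multiset.map_cons,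
      insert_val_of_notMem (by simp [hne]), Multiset.map_cons, singleton_val,
      Multiset.map_singleton, h1]
    rfl
  · rw [h2, h3, card_three_eq_add (P.Below w) (P.Below v)]
    unfold sub
    omega
  · intro h
    rw [h2]
    unfold sub
    rw [← card_filter_add_card_filter_not (s := filter (P.Below v) univ) (P.Below w),
      filter_filter, filter_filter, add_comm]
    congr 2
    ext u
    simp only [mem_filter, mem_univ, true_and]
    exact ⟨fun h' => ⟨h.trans h', h'⟩, And.right⟩
  · intro h
    rw [h2]
    unfold sub
    congr 1
    ext u
    simp only [mem_filter, mem_univ, true_and, and_iff_left_iff_imp]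
    exact fun h1 h2 => (h1.total h2).elim h hwv

theorem sum_offDiag {α : Type*} [DecidableEq α] (s : Finset α) (f : α → α → ℤ) :
    ∑ p ∈ s.offDiag, f p.1 p.2 = ∑ v ∈ s, ∑ w ∈ s, if v ≠ w then f v w else 0 := by
  rw [← sum_product' s s fun v w => if v ≠ w then f v w else 0, ← sum_filter]
  refine sum_congr ?_ fun _ _ => rfl
  ext p
  simp [and_assoc]

/-- Summing over ordered pairs of distinct elements counts every two-element subset twice. -/
theorem sum_offDiag_pair {α : Type*} [DecidableEq α] (s : Finset α) (f : Finset α → ℤ) :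
    ∑ p ∈ s.offDiag, f {p.1, p.2} = 2 * ∑ t ∈ s.powersetCard 2, f t := by
  rw [← Finset.sum_fiberwise_of_maps_to (t := s.powersetCard 2)
    (g := fun p : α × α => ({p.1, p.2} : Finset α)), mul_sum]
  · refine sum_congr rfl fun t ht => ?_
    rw [mem_powersetCard, card_eq_two] at ht
    obtain ⟨hts, a, b, hab, rfl⟩ := ht
    have : {p ∈ s.offDiag | ({p.1, p.2} : Finset α) = {a, b}} = {(a, b), (b, a)} := by
      ext ⟨x, y⟩
      have ha : a ∈ s := hts (by simp)
      have hb : b ∈ s := hts (by simp)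
      simp only [mem_filter, mem_offDiag, mem_insert, mem_singleton, Prod.mk.injEq]
      constructor
      · rintro ⟨⟨-, -, hxy⟩, h⟩
        have hx : x ∈ ({a, b} : Finset α) := h ▸ by simp
        have hy : y ∈ ({a, b} : Finset α) := h ▸ by simp
        simp only [mem_insert, mem_singleton] at hx hy
        rcases hx with rfl | rfl <;> rcases hy with rfl | rfl <;> simp_all
      · rintro (⟨rfl, rfl⟩ | ⟨rfl, rfl⟩)
        · exact ⟨⟨ha, hb, hab⟩, rfl⟩
        · exact ⟨⟨hb, ha, hab.symm⟩, pair_comm _ _⟩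
    rw [this, sum_pair (by simp [hab]), pair_comm b a]
    ring
  · rintro ⟨x, y⟩ h
    rw [mem_offDiag] at h
    rw [mem_powersetCard]
    refine ⟨?_, card_pair h.2.2⟩
    intro z hz
    simp only [mem_insert, mem_singleton] at hz
    rcases hz with rfl | rfl
    exacts [h.1, h.2.1]

theorem sum_cuts_eq (P : ParentTree V) (k : ℕ) (f : Finset V → ℤ) :
    ∑ C ∈ P.cuts, (if #C = k + 1 then f C else 0) =
      ∑ t ∈ (univ.erase P.root).powersetCard k, f (insert P.root t) := by
  rw [← sum_filter]
  refine sum_bij' (fun C _ => C.erase P.root) (fun t _ => insert P.root t) ?_ ?_ ?_ ?_ ?_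
  · intro C hC
    rw [mem_filter, mem_cuts] at hC
    rw [mem_powersetCard, card_erase_of_mem hC.1, hC.2]
    exact ⟨erase_subset_erase _ (subset_univ _), rfl⟩
  · intro t ht
    rw [mem_powersetCard] at ht
    rw [mem_filter, mem_cuts, card_insert_of_notMem fun h => notMem_erase _ _ (ht.1 h), ht.2]
    exact ⟨mem_insert_self _ _, rfl⟩
  · intro C hC
    exact insert_erase (P.mem_cuts.1 (mem_filter.1 hC).1)
  · intro t ht
    rw [mem_powersetCard] at ht
    exact erase_insert fun h => notMem_erase _ _ (ht.1 h)
  · intro C hC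
    rw [insert_erase (P.mem_cuts.1 (mem_filter.1 hC).1)]

theorem sum_cuts_card_two (P : ParentTree V) (g : Multiset ℕ → ℤ) :
    ∑ C ∈ P.cuts, (if Multiset.card (P.type C) = 2 then g (P.type C) else 0) =
      ∑ v ∈ univ.erase P.root, g {Fintype.card V - P.sub v, P.sub v} := by
  simp only [card_type]
  rw [P.sum_cuts_eq 1 fun C => g (P.type C), powersetCard_one, sum_map]
  exact sum_congr rfl fun v hv => by
    rw [← (P.type_pair (ne_of_mem_erase hv)).2]
    rfl

theorem sum_cuts_card_three (P : ParentTree V) (g : Multiset ℕ → ℤ) :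
    2 * ∑ C ∈ P.cuts, (if Multiset.card (P.type C) = 3 then g (P.type C) else 0) =
      ∑ p ∈ (univ.erase P.root).offDiag, g (P.type {P.root, p.1, p.2}) := by
  simp only [card_type]
  rw [P.sum_cuts_eq 2 fun C => g (P.type C), ← sum_offDiag_pair _ fun t => g (P.type (insert P.root t))]

/-- Only the edges above `v` and `w` are retained, and they form a component of three vertices
exactly if they share an end. -/
theorem three_mem_type_compl_pair_iff (P : ParentTree V) {v w : V} (hv : v ≠ P.root)
    (hw : w ≠ P.root) (hvw : v ≠ w) :
    3 ∈ P.type (univ \ {v, w}) ↔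
      P.parent v = w ∨ P.parent w = v ∨ P.parent v = P.parent w := by
  classical
  have hroot : P.root ∈ univ \ {v, w} := by simp [hv.symm, hw.symm]
  -- In these two cases the component has topmost vertex `P.parent v`; the remaining case exchanges
  -- `v` and `w`.
  have key : ∀ v w, v ≠ P.root → w ≠ P.root → v ≠ w → P.parent v ≠ w →
      (P.parent w = v ∨ P.parent v = P.parent w) → 3 ∈ P.type (univ \ {v, w}) := by
    intro v w hv hw hvw h1 h2
    have hroot : P.root ∈ univ \ {v, w} := by simp [hv.symm, hw.symm]
    have hpC : P.parent v ∈ univ \ {v, w} := by simp [h1, P.parent_ne_self hv]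
    have hvC : v ∉ univ \ {v, w} := by simp
    have hwC : w ∉ univ \ {v, w} := by simp
    have htv : P.top (univ \ {v, w}) v = P.parent v := by
      rw [P.top_of_notMem hroot hvC, P.top_of_mem hpC]
    have htw : P.top (univ \ {v, w}) w = P.parent v := by
      rcases h2 with h2 | h2
      · rw [P.top_of_notMem hroot hwC, h2, htv]
      · rw [P.top_of_notMem hroot hwC, ← h2, P.top_of_mem hpC]
    rw [type, Multiset.mem_map]
    refine ⟨P.parent v, hpC, ?_⟩
    have : ({u | P.top (univ \ {v, w}) u = P.parent v} : Finset V) = {P.parent v, v, w} := by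
      ext u
      simp only [mem_filter, mem_univ, true_and, mem_insert, mem_singleton]
      constructor
      · intro h
        by_cases hu : u ∈ univ \ {v, w}
        · rw [P.top_of_mem hu] at h
          exact Or.inl h
        · right
          simpa [or_iff_not_imp_left] using hu
      · rintro (rfl | rfl | rfl)
        exacts [P.top_of_mem hpC, htv, htw]
    rw [size, this, card_eq_three]
    exact ⟨_, _, _, P.parent_ne_self hv, h1, hvw, rfl⟩
  constructor
  · intro h
    by_contra! hne
    rw [type, Multiset.mem_map] at h
    obtain ⟨x, hx, hsize⟩ := h
    have hvC : v ∉ univ \ {v, w} := by simp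
    have hwC : w ∉ univ \ {v, w} := by simp
    have htv : P.top (univ \ {v, w}) v = P.parent v := by
      rw [P.top_of_notMem hroot hvC, P.top_of_mem (by simp [hne.1, P.parent_ne_self hv])]
    have htw : P.top (univ \ {v, w}) w = P.parent w := by
      rw [P.top_of_notMem hroot hwC, P.top_of_mem (by simp [hne.2.1, P.parent_ne_self hw])]
    -- Without a common end, a component contains at most one retained edge, hence at most two
    -- vertices.
    have hsub : ∃ y, ({u | P.top (univ \ {v, w}) u = x} : Finset V) ⊆ {x, y} := by
      by_cases hxv : P.parent v = x
      · refine ⟨v, fun u hu => ?_⟩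
        simp only [mem_filter, mem_univ, true_and] at hu
        by_cases huC : u ∈ univ \ {v, w}
        · rw [P.top_of_mem huC] at hu
          simp [hu]
        · simp only [mem_sdiff, mem_univ, true_and, mem_insert, mem_singleton, not_not] at huC
          rcases huC with rfl | rfl
          · simp
          · exact absurd (hxv.trans (hu.symm.trans htw)) hne.2.2
      · refine ⟨w, fun u hu => ?_⟩
        simp only [mem_filter, mem_univ, true_and] at hu
        by_cases huC : u ∈ univ \ {v, w}
        · rw [P.top_of_mem huC] at hu
          simp [hu]
        · simp only [mem_sdiff, mem_univ, true_and, mem_insert, mem_singleton, not_not] at huC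
          rcases huC with rfl | rfl
          · exact absurd (htv.symm.trans hu) hxv
          · simp
    obtain ⟨y, hy⟩ := hsub
    have h1 := card_le_card hy
    have h2 := card_le_two (a := x) (b := y)
    rw [size] at hsize
    omega
  · intro h
    by_cases h1 : P.parent v = w
    · have h2 : P.parent w ≠ v := fun h2 => by
        have e1 := P.rank_parent_lt v hv
        have e2 := P.rank_parent_lt w hw
        rw [h1] at e1
        rw [h2] at e2
        omega
      rw [pair_comm]
      exact key w v hw hv hvw.symm h2 (Or.inl h1)
    · exact key v w hv hw hvw h1 (h.resolve_left h1)

theorem sum_cuts_three_mem (P : ParentTree V) (hV : 3 ≤ Fintype.card V) :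
    2 * ∑ C ∈ P.cuts, (if Multiset.card (P.type C) = Fintype.card V - 2 ∧ 3 ∈ P.type C
        then 1 else 0 : ℤ) =
      ∑ p ∈ (univ.erase P.root).offDiag,
        if P.parent p.1 = p.2 ∨ P.parent p.2 = p.1 ∨ P.parent p.1 = P.parent p.2
          then 1 else 0 := by
  have h1 : ∑ C ∈ P.cuts, (if Multiset.card (P.type C) = Fintype.card V - 2 ∧ 3 ∈ P.type C
        then 1 else 0 : ℤ) =
      ∑ t ∈ (univ.erase P.root).powersetCard 2, if 3 ∈ P.type (univ \ t) then 1 else 0 := by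
    simp only [card_type, ite_and]
    rw [← sum_filter]
    refine sum_bij' (fun C _ => univ \ C) (fun t _ => univ \ t) ?_ ?_ ?_ ?_ ?_
    · intro C hC
      rw [mem_filter, mem_cuts] at hC
      rw [mem_powersetCard, card_sdiff_of_subset (subset_univ C), card_univ, hC.2]
      refine ⟨fun v hv => mem_erase.2 ⟨?_, mem_univ v⟩, by omega⟩
      rintro rfl
      exact (mem_sdiff.1 hv).2 hC.1
    · intro t ht
      rw [mem_powersetCard] at ht
      rw [mem_filter, mem_cuts, card_sdiff_of_subset (subset_univ t), card_univ, ht.2]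
      exact ⟨mem_sdiff.2 ⟨mem_univ _, fun h => notMem_erase _ _ (ht.1 h)⟩, rfl⟩
    · intro C _
      simp
    · intro t _
      simp
    · intro C _
      simp
  rw [h1, ← sum_offDiag_pair]
  refine sum_congr rfl fun p hp => ?_
  rw [mem_offDiag] at hp
  simp only [P.three_mem_type_compl_pair_iff (ne_of_mem_erase hp.1) (ne_of_mem_erase hp.2.1) hp.2.2]

/-- A nested pair occurs in two orders, both expressed with the ancestor first, hence the factor 2.
Incomparable pairs stay in both orders. -/
theorem sum_offDiag_eq (P : ParentTree V) (g : Multiset ℕ → ℤ) (γ : ℕ → ℕ → ℤ)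
    (hγ : ∀ x y z, x + y + z = Fintype.card V → g {x, y, z} = γ z y)
    [∀ v w, Decidable (P.Below v w)] :
    ∑ p ∈ (univ.erase P.root).offDiag, g (P.type {P.root, p.1, p.2}) =
      ∑ v ∈ univ.erase P.root, ∑ w ∈ univ.erase P.root,
        (2 * (if v ≠ w ∧ P.Below v w then γ (P.sub w) (P.sub v - P.sub w) else 0) +
          if ¬ P.Below v w ∧ ¬ P.Below w v then γ (P.sub w) (P.sub v) else 0) := by
  have hf : ∀ v w, v ≠ P.root → w ≠ P.root → ¬ P.Below w v → g (P.type {P.root, v, w}) =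
      if P.Below v w then γ (P.sub w) (P.sub v - P.sub w) else γ (P.sub w) (P.sub v) := by
    intro v w hv hw hwv
    obtain ⟨x, y, ht, hs, h1, h2⟩ := P.type_triple hv hw hwv
    rw [ht, hγ _ _ _ hs]
    split_ifs with h
    · rw [← h1 h, Nat.add_sub_cancel]
    · rw [h2 h]
  have hsplit : ∀ v ∈ univ.erase P.root, ∀ w ∈ univ.erase P.root,
      (if v ≠ w then g (P.type {P.root, v, w}) else 0) =
        (if v ≠ w ∧ P.Below v w then γ (P.sub w) (P.sub v - P.sub w) else 0) +
        (if w ≠ v ∧ P.Below w v then γ (P.sub v) (P.sub w - P.sub v) else 0) +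
        if ¬ P.Below v w ∧ ¬ P.Below w v then γ (P.sub w) (P.sub v) else 0 := by
    intro v hv w hw
    replace hv := ne_of_mem_erase hv
    replace hw := ne_of_mem_erase hw
    by_cases hvw : v = w
    · subst hvw
      simp [show P.Below v v from .refl]
    by_cases h1 : P.Below w v
    · have h2 : ¬ P.Below v w := fun h => hvw (h.antisymm h1)
      rw [pair_comm v w, hf w v hw hv h2]
      simp [h1, h2, hvw, Ne.symm hvw]
    · rw [hf v w hv hw h1]
      by_cases h2 : P.Below v w <;> simp [h1, h2, hvw]
  rw [sum_offDiag _ fun v w => g (P.type {P.root, v, w}),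
    sum_congr rfl fun v hv => sum_congr rfl (hsplit v hv)]
  simp only [sum_add_distrib, two_mul]
  congr 1
  congr 1
  rw [sum_comm]

/-- Two adjacent edges either form a chain, fixed by its lowest vertex, whose parent is not the
root, or hang from a common parent. The sibling sum runs over ordered pairs and therefore needs no
factor 2. -/
theorem sum_cuts_three_mem_eq (P : ParentTree V) (hV : 3 ≤ Fintype.card V) :
    2 * ∑ C ∈ P.cuts, (if Multiset.card (P.type C) = Fintype.card V - 2 ∧ 3 ∈ P.type C
        then 1 else 0 : ℤ) =
      2 * ∑ v ∈ univ.erase P.root, (if P.parent v = P.root then 0 else 1) +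
        ∑ v ∈ univ.erase P.root, ∑ w ∈ univ.erase P.root,
          if v ≠ w ∧ P.parent v = P.parent w then 1 else 0 := by
  have h1 : ∀ v ∈ univ.erase P.root, (if P.parent v = P.root then 0 else 1 : ℤ) =
      ∑ w ∈ univ.erase P.root, if P.parent v = w then 1 else 0 := fun v _ => by
    rw [sum_ite_eq]
    simp
  rw [P.sum_cuts_three_mem hV, sum_congr rfl h1, two_mul]
  nth_rw 2 [sum_comm]
  rw [sum_offDiag _ fun v w =>
    if P.parent v = w ∨ P.parent w = v ∨ P.parent v = P.parent w then 1 else 0,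
    ← sum_add_distrib, ← sum_add_distrib]
  refine sum_congr rfl fun v hv => ?_
  rw [← sum_add_distrib, ← sum_add_distrib]
  refine sum_congr rfl fun w hw => ?_
  replace hv := ne_of_mem_erase hv
  replace hw := ne_of_mem_erase hw
  have e1 := P.rank_parent_lt v hv
  have e2 := P.rank_parent_lt w hw
  have e3 := P.parent_ne_self hv
  have e4 := P.parent_ne_self hw
  by_cases hvw : v = w
  · subst hvw
    simp [e3]
  by_cases h1 : P.parent v = w
  · have h2 : P.parent w ≠ v := fun h2 => by
      rw [h1] at e1
      rw [h2] at e2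
      omega
    simp [h1, h2, hvw, e4.symm]
  by_cases h2 : P.parent w = v
  · simp [h1, h2, hvw, e3]
  · simp [h1, h2, hvw]

end ParentTree

/-! ### Spiders with forked legs -/

/-- The legs of a 2-spider: the number of vertices of each leg, and whether it ends in a fork. -/
structure LegData (ι : Type*) where
  size : ι → ℕ
  fork : ι → Prop
  size_pos : ∀ i, 0 < size i
  three_le_size : ∀ i, fork i → 3 ≤ size i

namespace LegData

variable {ι : Type*}

open Classical in
/-- The parent of a vertex in the tree with the given legs. The vertices of leg `i` are numbered
from the outside; if the leg ends in a fork, `0` and `1` are the two leaves. -/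
noncomputable def parent (D : LegData ι) :
    Option (Σ i, Fin (D.size i)) → Option (Σ i, Fin (D.size i))
  | none => none
  | some ⟨i, h⟩ =>
    if hf : D.fork i ∧ (h : ℕ) = 0 then some ⟨i, ⟨2, D.three_le_size i hf.1⟩⟩
    else if hs : (h : ℕ) + 1 < D.size i then some ⟨i, ⟨h + 1, hs⟩⟩
    else none

theorem parent_of_fork (D : LegData ι) {i : ι} (hf : D.fork i) (h : Fin (D.size i))
    (hh : (h : ℕ) = 0) : D.parent (some ⟨i, h⟩) = some ⟨i, ⟨2, D.three_le_size i hf⟩⟩ := by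
  rw [parent, dif_pos ⟨hf, hh⟩]

theorem parent_of_lt (D : LegData ι) {i : ι} (h : Fin (D.size i))
    (hf : ¬ (D.fork i ∧ (h : ℕ) = 0)) (hs : (h : ℕ) + 1 < D.size i) :
    D.parent (some ⟨i, h⟩) = some ⟨i, ⟨h + 1, hs⟩⟩ := by
  rw [parent, dif_neg hf, dif_pos hs]

theorem parent_of_eq (D : LegData ι) {i : ι} (h : Fin (D.size i))
    (hs : (h : ℕ) + 1 = D.size i) : D.parent (some ⟨i, h⟩) = none := by
  have hf : ¬ (D.fork i ∧ (h : ℕ) = 0) := fun hf => by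
    have := D.three_le_size i hf.1
    omega
  rw [parent, dif_neg hf, dif_neg hs.not_lt]

/-- The 2-spider with the given legs, rooted at its torso. -/
noncomputable def tree (D : LegData ι) : ParentTree (Option (Σ i, Fin (D.size i))) where
  root := none
  parent := D.parent
  rank v := v.elim 0 fun x => D.size x.1 - x.2
  rank_parent_lt v hv := by
    obtain ⟨i, h⟩ | _ := v
    · exact absurd rfl hv
    · rename_i x
      obtain ⟨i, h⟩ := x
      have hlt := h.2
      by_cases hf : D.fork i ∧ (h : ℕ) = 0
      · rw [D.parent_of_fork hf.1 h hf.2]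
        have := D.three_le_size i hf.1
        simp only [Option.elim]
        omega
      · by_cases hs : (h : ℕ) + 1 < D.size i
        · rw [D.parent_of_lt h hf hs]
          simp only [Option.elim]
          omega
        · rw [D.parent_of_eq h (by omega)]
          simp only [Option.elim]
          omega

theorem tree_parent (D : LegData ι) : D.tree.parent = D.parent := rfl

theorem tree_root (D : LegData ι) : D.tree.root = none := rfl

/-- A leg is ordered by position, except that the two leaves 0 and 1 of a fork are incomparable. -/
theorem below_some_iff (D : LegData ι) {i : ι} (h : Fin (D.size i))
    (u : Option (Σ i, Fin (D.size i))) :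
    D.tree.Below (some ⟨i, h⟩) u ↔
      ∃ g : Fin (D.size i), u = some ⟨i, g⟩ ∧ g ≤ h ∧ ¬ (D.fork i ∧ (h : ℕ) = 1 ∧ (g : ℕ) = 0) := by
  constructor
  · intro hu
    induction hu with
    | refl => exact ⟨h, rfl, le_rfl, by omega⟩
    | step u hu _ ih =>
      obtain ⟨g, hg, hgh, hgf⟩ := ih
      rcases u with _ | ⟨j, l⟩
      · exact absurd rfl hu
      rw [tree_parent] at hg
      rw [Fin.le_def] at hgh
      by_cases hf : D.fork j ∧ (l : ℕ) = 0
      · rw [D.parent_of_fork hf.1 l hf.2, Option.some_inj, Sigma.mk.injEq] at hg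
        obtain ⟨rfl, hg⟩ := hg
        have := congrArg Fin.val (eq_of_heq hg)
        simp only at this
        exact ⟨l, rfl, by rw [Fin.le_def]; omega, by omega⟩
      · by_cases hs : (l : ℕ) + 1 < D.size j
        · rw [D.parent_of_lt l hf hs, Option.some_inj, Sigma.mk.injEq] at hg
          obtain ⟨rfl, hg⟩ := hg
          have := congrArg Fin.val (eq_of_heq hg)
          simp only at this
          exact ⟨l, rfl, by rw [Fin.le_def]; omega, fun h' => hf ⟨h'.1, h'.2.2⟩⟩
        · rw [D.parent_of_eq l (by omega)] at hg
          exact absurd hg (by simp)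
  · rintro ⟨g, rfl, hgh, hgf⟩
    rw [Fin.le_def] at hgh
    induction hn : (h : ℕ) - g using Nat.strong_induction_on generalizing g with
    | _ n ih =>
      by_cases hg : g = h
      · subst hg
        exact .refl
      have hlt : (g : ℕ) < h := lt_of_le_of_ne hgh fun h' => hg (Fin.ext h')
      refine .step _ (by exact Option.some_ne_none _) ?_
      rw [tree_parent]
      by_cases hf : D.fork i ∧ (g : ℕ) = 0
      · rw [D.parent_of_fork hf.1 g hf.2]
        -- The parent of the fork leaf 0 is at position 2, so the induction continues only if `h` is
        -- not the other leaf.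
        have h1 : (h : ℕ) ≠ 1 := fun h1 => hgf ⟨hf.1, h1, hf.2⟩
        exact ih (h - 2) (by omega) ⟨2, _⟩ (by simp only; omega) (by simp only; omega) rfl
      · have hs : (g : ℕ) + 1 < D.size i := by have := h.2; omega
        rw [D.parent_of_lt g hf hs]
        exact ih (h - (g + 1)) (by omega) ⟨g + 1, hs⟩ (by simp only; omega) (by simp only; omega)
          rfl

open Classical in
/-- The size of the subtree at the vertex `h` of leg `i`. -/
noncomputable def legSub (D : LegData ι) (i : ι) (h : ℕ) : ℕ :=
  if D.fork i ∧ h = 1 then 1 else h + 1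

theorem below_some_some_iff (D : LegData ι) {i j : ι} (h : Fin (D.size i)) (g : Fin (D.size j)) :
    D.tree.Below (some ⟨i, h⟩) (some ⟨j, g⟩) ↔
      i = j ∧ (g : ℕ) ≤ h ∧ ¬ (D.fork i ∧ (h : ℕ) = 1 ∧ (g : ℕ) = 0) := by
  rw [below_some_iff]
  constructor
  · rintro ⟨g', hg, h1, h2⟩
    rw [Option.some_inj, Sigma.mk.injEq] at hg
    obtain ⟨rfl, hg⟩ := hg
    obtain rfl := eq_of_heq hg
    exact ⟨rfl, h1, h2⟩
  · rintro ⟨rfl, h1, h2⟩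
    exact ⟨g, rfl, h1, h2⟩

theorem parent_eq_none_iff (D : LegData ι) {i : ι} (h : Fin (D.size i)) :
    D.parent (some ⟨i, h⟩) = none ↔ (h : ℕ) + 1 = D.size i := by
  refine ⟨fun hn => ?_, D.parent_of_eq h⟩
  have hlt := h.2
  by_contra hs
  by_cases hf : D.fork i ∧ (h : ℕ) = 0
  · rw [D.parent_of_fork hf.1 h hf.2] at hn
    exact Option.some_ne_none _ hn
  · rw [D.parent_of_lt h hf (by omega)] at hn
    exact Option.some_ne_none _ hn

theorem parent_eq_some_iff (D : LegData ι) {i j : ι} (h : Fin (D.size i)) (l : Fin (D.size j)) :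
    D.parent (some ⟨i, h⟩) = some ⟨j, l⟩ ↔
      i = j ∧ ((D.fork i ∧ (h : ℕ) = 0 ∧ (l : ℕ) = 2) ∨
        (¬ (D.fork i ∧ (h : ℕ) = 0) ∧ (l : ℕ) = h + 1)) := by
  have hlt := h.2
  constructor
  · intro hp
    by_cases hf : D.fork i ∧ (h : ℕ) = 0
    · rw [D.parent_of_fork hf.1 h hf.2, Option.some_inj, Sigma.mk.injEq] at hp
      obtain ⟨rfl, hp⟩ := hp
      have := congrArg Fin.val (eq_of_heq hp)
      exact ⟨rfl, Or.inl ⟨hf.1, hf.2, this.symm⟩⟩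
    · by_cases hs : (h : ℕ) + 1 < D.size i
      · rw [D.parent_of_lt h hf hs, Option.some_inj, Sigma.mk.injEq] at hp
        obtain ⟨rfl, hp⟩ := hp
        have := congrArg Fin.val (eq_of_heq hp)
        exact ⟨rfl, Or.inr ⟨hf, this.symm⟩⟩
      · rw [D.parent_of_eq h (by omega)] at hp
        exact absurd hp (Option.some_ne_none _).symm
  · rintro ⟨rfl, ⟨hf, h0, hl⟩ | ⟨hf, hl⟩⟩
    · obtain rfl : l = ⟨2, D.three_le_size i hf⟩ := Fin.ext hl
      exact D.parent_of_fork hf h h0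
    · have hs : (h : ℕ) + 1 < D.size i := hl ▸ l.2
      obtain rfl : l = ⟨h + 1, hs⟩ := Fin.ext hl
      exact D.parent_of_lt h hf hs

theorem parent_eq_parent_iff (D : LegData ι) {i j : ι} (h : Fin (D.size i)) (g : Fin (D.size j)) :
    D.parent (some ⟨i, h⟩) = D.parent (some ⟨j, g⟩) ↔
      ((h : ℕ) + 1 = D.size i ∧ (g : ℕ) + 1 = D.size j) ∨
        i = j ∧ ((h : ℕ) = g ∨ D.fork i ∧ (h : ℕ) ≤ 1 ∧ (g : ℕ) ≤ 1) := by
  have hlt := h.2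
  have glt := g.2
  rcases hp : D.parent (some ⟨j, g⟩) with _ | ⟨k, l⟩
  · rw [parent_eq_none_iff] at hp ⊢
    refine ⟨fun h' => Or.inl ⟨h', hp⟩, ?_⟩
    rintro (h' | ⟨rfl, h' | ⟨hf, h1, h2⟩⟩)
    · exact h'.1
    · omega
    · have := D.three_le_size i hf
      omega
  · rw [parent_eq_some_iff] at hp ⊢
    obtain ⟨rfl, hp⟩ := hp
    have hl := l.2
    by_cases hij : i = j
    · subst hij
      by_cases hf : D.fork i <;> simp only [hf, true_and, false_and, false_or, not_false_eq_true,
        or_false] at hp ⊢ <;> omega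
    · simp only [hij, false_and, or_false, false_iff, not_and]
      omega

/-- The number of vertices of leg `i` whose subtree has `x` vertices. -/
noncomputable def legCount (D : LegData ι) (i : ι) (x : ℕ) : ℤ :=
  ∑ h ∈ range (D.size i), if D.legSub i h = x then 1 else 0

/-- A fork changes only the subtree sizes 1 and 2; any size `x ≥ 3` can occur only at position `x -
1`. -/
theorem legCount_of_three_le (D : LegData ι) (i : ι) {x : ℕ} (hx : 3 ≤ x) :
    D.legCount i x = if x ≤ D.size i then 1 else 0 := by
  have h : ∀ h, (D.legSub i h = x) = (x - 1 = h) := fun h => by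
    unfold legSub
    rw [eq_iff_iff]
    split_ifs <;> omega
  simp only [legCount, h]
  rw [sum_ite_eq]
  exact if_congr (by rw [mem_range]; omega) rfl rfl

theorem legCount_two (D : LegData ι) (i : ι) [Decidable (D.fork i)] :
    D.legCount i 2 = if 2 ≤ D.size i ∧ ¬ D.fork i then 1 else 0 := by
  by_cases hf : D.fork i
  · have h : ∀ h, D.legSub i h ≠ 2 := fun h => by
      simp only [legSub, hf, true_and]
      split_ifs <;> omega
    simp [legCount, h, hf]
  · have h : ∀ h, (D.legSub i h = 2) = (1 = h) := fun h => by
      simp only [legSub, hf, false_and, if_false, eq_iff_iff]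
      omega
    simp only [legCount, h]
    rw [sum_ite_eq]
    exact if_congr (by rw [mem_range]; simp [hf]; omega) rfl rfl

theorem legCount_one (D : LegData ι) (i : ι) [Decidable (D.fork i)] :
    D.legCount i 1 = 1 + if D.fork i then 1 else 0 := by
  have hpos := D.size_pos i
  by_cases hf : D.fork i
  · have h3 := D.three_le_size i hf
    have h : ∀ h, (if D.legSub i h = 1 then 1 else 0 : ℤ) =
        (if 0 = h then 1 else 0) + if 1 = h then 1 else 0 := fun h => by
      simp only [legSub, hf, true_and]
      split_ifs <;> omega
    simp only [legCount, h, sum_add_distrib, sum_ite_eq, mem_range, hf]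
    rw [if_pos hpos, if_pos (by omega)]
    rfl
  · have h : ∀ h, (D.legSub i h = 1) = (0 = h) := fun h => by
      simp only [legSub, hf, false_and, if_false, eq_iff_iff]
      omega
    simp only [legCount, h, sum_ite_eq, mem_range, hf]
    simp [hpos]

variable [Fintype ι]

theorem card_eq (D : LegData ι) :
    Fintype.card (Option (Σ i, Fin (D.size i))) = ∑ i, D.size i + 1 := by
  simp

theorem sub_some [DecidableEq ι] (D : LegData ι) {i : ι} (h : Fin (D.size i)) :
    D.tree.sub (some ⟨i, h⟩) = D.legSub i h := by
  classical
  have hb : D.tree.sub (some ⟨i, h⟩) =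
      #{g ∈ range (h + 1) | ¬ (D.fork i ∧ (h : ℕ) = 1 ∧ g = 0)} := by
    symm
    unfold ParentTree.sub
    refine card_bij (fun g hg => some ⟨i, ⟨g, ?_⟩⟩) ?_ ?_ ?_
    · have := mem_range.1 (mem_filter.1 hg).1
      have := h.2
      omega
    · intro g hg
      rw [mem_filter, mem_range] at hg
      rw [mem_filter, below_some_some_iff]
      exact ⟨mem_univ _, rfl, by simp only; omega, hg.2⟩
    · intro g hg g' hg' heq
      simpa using heq
    · intro u hu
      rw [mem_filter, below_some_iff] at hu
      obtain ⟨-, g, rfl, h1, h2⟩ := hu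
      refine ⟨g, ?_, rfl⟩
      rw [mem_filter, mem_range]
      exact ⟨by have := Fin.le_def.1 h1; omega, h2⟩
  rw [hb, legSub]
  split_ifs with hf
  · have : {g ∈ range ((h : ℕ) + 1) | ¬ (D.fork i ∧ (h : ℕ) = 1 ∧ g = 0)} = {1} := by
      ext g
      simp only [mem_filter, mem_range, mem_singleton, hf.1, hf.2, true_and]
      omega
    rw [this, card_singleton]
  · rw [filter_true_of_mem, card_range]
    exact fun g _ h' => hf ⟨h'.1, h'.2.1⟩

theorem sum_erase_root [DecidableEq ι] (D : LegData ι) (f : Option (Σ i, Fin (D.size i)) → ℤ) :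
    ∑ v ∈ univ.erase D.tree.root, f v = ∑ i, ∑ h : Fin (D.size i), f (some ⟨i, h⟩) := by
  have : univ.erase D.tree.root = univ.map Function.Embedding.some := by
    change univ.erase none = _
    ext v
    cases v <;> simp
  rw [this, sum_map, ← univ_sigma_univ, sum_sigma]
  rfl


open Classical in
/-- The number of legs with at least `x` vertices. -/
noncomputable def legs (D : LegData ι) (x : ℕ) : ℤ := ∑ i, if x ≤ D.size i then 1 else 0

open Classical in
/-- The number of legs without fork with at least `x` vertices. -/
noncomputable def plainLegs (D : LegData ι) (x : ℕ) : ℤ :=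
  ∑ i, if x ≤ D.size i ∧ ¬ D.fork i then 1 else 0

open Classical in
/-- The number of legs with a fork. -/
noncomputable def forks (D : LegData ι) : ℤ := ∑ i, if D.fork i then 1 else 0

theorem sum_legCount_of_three_le (D : LegData ι) {x : ℕ} (hx : 3 ≤ x) :
    ∑ i, D.legCount i x = D.legs x :=
  sum_congr rfl fun i _ => (D.legCount_of_three_le i hx).trans (if_congr Iff.rfl rfl rfl)

theorem sum_legCount_two (D : LegData ι) : ∑ i, D.legCount i 2 = D.plainLegs 2 := by
  classical
  exact sum_congr rfl fun i _ => (D.legCount_two i).trans (if_congr Iff.rfl rfl rfl)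

theorem sum_legCount_one (D : LegData ι) : ∑ i, D.legCount i 1 = Fintype.card ι + D.forks := by
  classical
  simp only [legCount_one, sum_add_distrib, sum_const, card_univ, nsmul_eq_mul, mul_one, forks]

/-- A removed edge leaves a subtree and its complement, and either may have size `j`. Two equal
parts count twice on both sides. -/
theorem sum_cuts_card_two [DecidableEq ι] (D : LegData ι) {j : ℕ} (hj : j ≤ ∑ i, D.size i) :
    ∑ C ∈ D.tree.cuts, (if Multiset.card (D.tree.type C) = 2
        then ((D.tree.type C).count j : ℤ) else 0) =
      ∑ i, D.legCount i j + ∑ i, D.legCount i (∑ i, D.size i + 1 - j) := by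
  rw [D.tree.sum_cuts_card_two fun l => (l.count j : ℤ)]
  have : ∀ v ∈ univ.erase D.tree.root,
      (Multiset.count j {Fintype.card (Option (Σ i, Fin (D.size i))) - D.tree.sub v,
        D.tree.sub v} : ℤ) = (if D.tree.sub v = j then 1 else 0) +
          if D.tree.sub v = ∑ i, D.size i + 1 - j then 1 else 0 := by
    intro v hv
    have h := (D.tree.type_pair (ne_of_mem_erase hv)).1
    rw [card_eq] at h ⊢
    rw [Multiset.insert_eq_cons, Multiset.count_cons, Multiset.count_singleton]
    push_cast
    rw [if_congr (show j = D.tree.sub v ↔ D.tree.sub v = j from eq_comm) rfl rfl]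
    congr 1
    exact if_congr (by omega) rfl rfl
  rw [sum_congr rfl this, sum_add_distrib, D.sum_erase_root, D.sum_erase_root]
  simp only [sub_some]
  congr 1 <;> refine sum_congr rfl fun i _ => ?_
  · exact Fin.sum_univ_eq_sum_range (fun h => if D.legSub i h = j then (1 : ℤ) else 0) _
  · exact Fin.sum_univ_eq_sum_range
      (fun h => if D.legSub i h = ∑ i, D.size i + 1 - j then (1 : ℤ) else 0) _

end LegData

/-! ### Adjacent edges in a 2-spider -/

namespace LegData
variable {ι : Type*}

theorem sum_siblings_same (D : LegData ι) (i : ι) [Decidable (D.fork i)] :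
    ∑ h ∈ range (D.size i), ∑ g ∈ range (D.size i),
      (if h ≠ g ∧ ((h + 1 = D.size i ∧ g + 1 = D.size i) ∨ h = g ∨ D.fork i ∧ h ≤ 1 ∧ g ≤ 1)
        then 1 else 0 : ℤ) = 2 * if D.fork i then 1 else 0 := by
  by_cases hf : D.fork i
  · have h3 := D.three_le_size i hf
    have key : ∀ h g, (if h ≠ g ∧ ((h + 1 = D.size i ∧ g + 1 = D.size i) ∨ h = g ∨
        D.fork i ∧ h ≤ 1 ∧ g ≤ 1) then 1 else 0 : ℤ) =
        (if 0 = h then if 1 = g then 1 else 0 else 0) +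
          if 1 = h then if 0 = g then 1 else 0 else 0 := by
      intro h g
      simp only [hf, true_and]
      split_ifs <;> omega
    have h0 : 0 ∈ range (D.size i) := mem_range.2 (by omega)
    have h1 : 1 ∈ range (D.size i) := mem_range.2 (by omega)
    simp only [key]
    simp only [sum_add_distrib, sum_ite_irrel, sum_const_zero, sum_ite_eq, hf, if_true, h0, h1]
    rfl
  · have key : ∀ h g, ¬ (h ≠ g ∧ ((h + 1 = D.size i ∧ g + 1 = D.size i) ∨ h = g ∨
        D.fork i ∧ h ≤ 1 ∧ g ≤ 1)) := by
      intro h g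
      simp only [hf, false_and, or_false]
      omega
    simp only [key]
    simp only [if_false, sum_const_zero, hf, mul_zero]

theorem sum_siblings_ne (D : LegData ι) (i j : ι) :
    ∑ h ∈ range (D.size i), ∑ g ∈ range (D.size j),
      (if h + 1 = D.size i ∧ g + 1 = D.size j then 1 else 0 : ℤ) = 1 := by
  have hi := D.size_pos i
  have hj := D.size_pos j
  have key : ∀ h g, (if h + 1 = D.size i ∧ g + 1 = D.size j then 1 else 0 : ℤ) =
      if D.size i - 1 = h then if D.size j - 1 = g then 1 else 0 else 0 := by
    intro h g
    split_ifs <;> omega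
  have h0 : D.size i - 1 ∈ range (D.size i) := mem_range.2 (by omega)
  have h1 : D.size j - 1 ∈ range (D.size j) := mem_range.2 (by omega)
  simp only [key, sum_ite_irrel, sum_const_zero, sum_ite_eq, if_true, h0, h1]

theorem sum_fin_fin (m n : ℕ) (f : ℕ → ℕ → ℤ) :
    ∑ h : Fin m, ∑ g : Fin n, f h g = ∑ h ∈ range m, ∑ g ∈ range n, f h g := by
  rw [← Fin.sum_univ_eq_sum_range (fun h => ∑ g ∈ range n, f h g)]
  exact sum_congr rfl fun h _ => Fin.sum_univ_eq_sum_range (f h) n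

variable [Fintype ι]

theorem sum_ne_eq [DecidableEq ι] (a b : ι → ℤ) :
    ∑ i, ∑ j, (if i = j then 0 else a i * b j) = (∑ i, a i) * ∑ i, b i - ∑ i, a i * b i := by
  rw [sum_mul_sum, ← sum_sub_distrib]
  refine sum_congr rfl fun i _ => ?_
  rw [eq_sub_iff_add_eq, ← sum_erase_add _ _ (mem_univ i), ← sum_erase_add _ _ (mem_univ i),
    if_pos rfl, add_zero]
  congr 1
  exact sum_congr rfl fun j hj => if_neg (ne_of_mem_erase hj).symm

/-- The torso has one child per leg, and each fork contributes its two leaves in both orders. -/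
theorem sum_siblings [DecidableEq ι] (D : LegData ι) :
    ∑ v ∈ univ.erase D.tree.root, ∑ w ∈ univ.erase D.tree.root,
      (if v ≠ w ∧ D.tree.parent v = D.tree.parent w then 1 else 0 : ℤ) =
        Fintype.card ι * Fintype.card ι - Fintype.card ι + 2 * D.forks := by
  classical
  have hpair : ∀ i j, ∑ h : Fin (D.size i), ∑ g : Fin (D.size j),
      (if (some ⟨i, h⟩ : Option (Σ i, Fin (D.size i))) ≠ some ⟨j, g⟩ ∧
        D.tree.parent (some ⟨i, h⟩) = D.tree.parent (some ⟨j, g⟩) then 1 else 0 : ℤ) =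
        (if i = j then 0 else 1 * 1) + if i = j then 2 * (if D.fork i then 1 else 0) else 0 := by
    intro i j
    by_cases hij : i = j
    · subst hij
      rw [if_pos rfl, if_pos rfl, zero_add, ← sum_siblings_same, ← sum_fin_fin]
      refine sum_congr rfl fun h _ => sum_congr rfl fun g _ => if_congr ?_ rfl rfl
      rw [tree_parent, parent_eq_parent_iff]
      simp [Fin.ext_iff]
    · rw [if_neg hij, if_neg hij, add_zero, mul_one]
      refine Eq.trans ?_ (D.sum_siblings_ne i j)
      rw [← sum_fin_fin]
      refine sum_congr rfl fun h _ => sum_congr rfl fun g _ => if_congr ?_ rfl rfl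
      rw [tree_parent, parent_eq_parent_iff]
      simp [hij]
  simp only [D.sum_erase_root]
  rw [sum_congr rfl fun i _ => sum_comm]
  simp only [hpair, sum_add_distrib]
  rw [sum_ne_eq]
  simp only [sum_ite_eq, mem_univ, if_true, ← mul_sum, sum_const, card_univ, nsmul_eq_mul, mul_one,
    forks]

theorem sum_cuts_three_mem [DecidableEq ι] (D : LegData ι) (hD : 2 ≤ ∑ i, D.size i) :
    2 * ∑ C ∈ D.tree.cuts, (if Multiset.card (D.tree.type C) = ∑ i, D.size i + 1 - 2 ∧
        3 ∈ D.tree.type C then 1 else 0 : ℤ) =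
      2 * (∑ i, D.size i - Fintype.card ι : ℤ) +
        (Fintype.card ι * Fintype.card ι - Fintype.card ι + 2 * D.forks) := by
  have h := D.tree.sum_cuts_three_mem_eq (by rw [card_eq]; omega)
  rw [card_eq, D.sum_siblings] at h
  rw [h, D.sum_erase_root]
  congr 2
  have hone : ∀ i, ∑ h : Fin (D.size i), (if D.tree.parent (some ⟨i, h⟩) = D.tree.root
      then 0 else 1 : ℤ) = D.size i - 1 := by
    intro i
    have hpos := D.size_pos i
    have key : ∀ h : Fin (D.size i), (if D.tree.parent (some ⟨i, h⟩) = D.tree.root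
        then 0 else 1 : ℤ) = 1 - if D.size i - 1 = (h : ℕ) then 1 else 0 := by
      intro h
      rw [tree_parent, tree_root, if_congr (D.parent_eq_none_iff h) rfl rfl]
      split_ifs <;> omega
    simp only [key, sum_sub_distrib]
    rw [Fin.sum_univ_eq_sum_range (fun h => if D.size i - 1 = h then (1 : ℤ) else 0), sum_ite_eq,
      if_pos (mem_range.2 (by omega))]
    simp
  simp only [hone, sum_sub_distrib]
  simp

end LegData

/-- The indicator function of the pair `(p, q)`. -/
def pairIndicator (p q x y : ℕ) : ℤ := if x = p ∧ y = q then 1 else 0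

/-- For a multiset `{x, y, z}` with sum `2 + b + c`, the number of its arrangements in the order
`2, b, c`, expressed by `x` and `y`. -/
def tripleIndicator (b c x y : ℕ) : ℤ :=
  pairIndicator 2 b x y + pairIndicator b 2 x y + (pairIndicator 2 c x y + pairIndicator c 2 x y) +
    (pairIndicator b c x y + pairIndicator c b x y)

/-- As `b ≠ 2`, the product counts ordered choices of two different parts, one equal to 2 and one to
`b`; the sum forces the third to be `c`. -/
theorem count_mul_count_eq_tripleIndicator {b c x y z : ℕ} (hb : 3 ≤ b)
    (h : x + y + z = 2 + b + c) :
    (Multiset.count 2 {x, y, z} : ℤ) * (Multiset.count b {x, y, z} : ℤ) =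
      tripleIndicator b c z y := by
  have same : ∀ w, (if 2 = w then 1 else 0 : ℤ) * (if b = w then 1 else 0) = 0 := fun w => by
    split_ifs <;> omega
  have e1 : (if 2 = z then 1 else 0 : ℤ) * (if b = y then 1 else 0) = pairIndicator 2 b z y := by
    unfold pairIndicator; split_ifs <;> omega
  have e2 : (if 2 = y then 1 else 0 : ℤ) * (if b = z then 1 else 0) = pairIndicator b 2 z y := by
    unfold pairIndicator; split_ifs <;> omega
  have e3 : (if 2 = z then 1 else 0 : ℤ) * (if b = x then 1 else 0) = pairIndicator 2 c z y := by
    unfold pairIndicator; split_ifs <;> omega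
  have e4 : (if 2 = y then 1 else 0 : ℤ) * (if b = x then 1 else 0) = pairIndicator c 2 z y := by
    unfold pairIndicator; split_ifs <;> omega
  have e5 : (if 2 = x then 1 else 0 : ℤ) * (if b = z then 1 else 0) = pairIndicator b c z y := by
    unfold pairIndicator; split_ifs <;> omega
  have e6 : (if 2 = x then 1 else 0 : ℤ) * (if b = y then 1 else 0) = pairIndicator c b z y := by
    unfold pairIndicator; split_ifs <;> omega
  simp only [Multiset.insert_eq_cons, Multiset.count_cons, Multiset.count_singleton,
    tripleIndicator]
  push_cast
  linear_combination e1 + e2 + e3 + e4 + e5 + e6 + same x + same y + same z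

/-! ### Three-part types of a 2-spider -/

namespace LegData

variable {ι : Type*}

theorem sum_pairIndicator (D : LegData ι) (i j : ι) (p q : ℕ) :
    ∑ h ∈ range (D.size i), ∑ g ∈ range (D.size j),
      pairIndicator p q (D.legSub j g) (D.legSub i h) = D.legCount i q * D.legCount j p := by
  rw [legCount, legCount, sum_mul_sum]
  refine sum_congr rfl fun h _ => sum_congr rfl fun g _ => ?_
  unfold pairIndicator
  split_ifs <;> simp_all

open Classical in
-- The sizes force the positions `p - 1` and `p + q - 1`. The only further obstruction is that a
-- forked leg has no subtree with two vertices.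
theorem sum_nested_pairIndicator (D : LegData ι) (i : ι) {p q : ℕ} (hp : 2 ≤ p) (hq : 2 ≤ q) :
    ∑ h ∈ range (D.size i), ∑ g ∈ range (D.size i),
      (if g < h ∧ ¬ (D.fork i ∧ h = 1 ∧ g = 0)
        then pairIndicator p q (D.legSub i g) (D.legSub i h - D.legSub i g) else 0) =
      if p + q ≤ D.size i ∧ ¬ (D.fork i ∧ p = 2) then 1 else 0 := by
  by_cases hf : D.fork i ∧ p = 2
  · rw [if_neg fun h => h.2 hf]
    refine sum_eq_zero fun h _ => sum_eq_zero fun g _ => ?_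
    simp only [pairIndicator, legSub, hf.1, hf.2, true_and]
    split_ifs <;> omega
  · have key : ∀ h g, (if g < h ∧ ¬ (D.fork i ∧ h = 1 ∧ g = 0)
        then pairIndicator p q (D.legSub i g) (D.legSub i h - D.legSub i g) else 0) =
        if p + q - 1 = h then if p - 1 = g then 1 else 0 else 0 := by
      intro h g
      unfold pairIndicator legSub
      by_cases hf' : D.fork i
      · simp only [hf', true_and] at hf ⊢
        split_ifs <;> omega
      · simp only [hf', false_and, if_false, not_false_eq_true, and_true]
        split_ifs <;> omega
    simp only [key]
    simp only [sum_ite_irrel, sum_const_zero, sum_ite_eq, mem_range, hf, not_false_eq_true, and_true]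
    split_ifs <;> omega

variable [Fintype ι]

theorem sum_legCount_two_mul (D : LegData ι) {b : ℕ} (hb : 3 ≤ b) :
    ∑ i, D.legCount i 2 * D.legCount i b = D.plainLegs b := by
  classical
  refine sum_congr rfl fun i _ => ?_
  rw [D.legCount_of_three_le i hb, D.legCount_two i]
  by_cases hf : D.fork i <;> simp only [hf, not_true, not_false_eq_true, and_true, and_false]
  · simp
  · split_ifs <;> omega

theorem sum_legCount_mul (D : LegData ι) {b c : ℕ} (hb : 3 ≤ b) (hc : 3 ≤ c) :
    ∑ i, D.legCount i b * D.legCount i c = D.legs (max b c) := by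
  refine sum_congr rfl fun i _ => ?_
  rw [D.legCount_of_three_le i hb, D.legCount_of_three_le i hc]
  split_ifs <;> omega

theorem sum_nested_tripleIndicator (D : LegData ι) [DecidablePred D.fork] {b c : ℕ} (hb : 3 ≤ b)
    (hc : 3 ≤ c) :
    ∑ i, ∑ h ∈ range (D.size i), ∑ g ∈ range (D.size i),
      (if g < h ∧ ¬ (D.fork i ∧ h = 1 ∧ g = 0)
        then tripleIndicator b c (D.legSub i g) (D.legSub i h - D.legSub i g) else 0) =
      D.plainLegs (b + 2) + D.plainLegs (c + 2) + D.legs (b + 2) + D.legs (c + 2) +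
        2 * D.legs (b + c) := by
  classical
  have hplain : ∀ x, 3 ≤ x → ∑ i, ∑ h ∈ range (D.size i), ∑ g ∈ range (D.size i),
      (if g < h ∧ ¬ (D.fork i ∧ h = 1 ∧ g = 0)
        then pairIndicator 2 x (D.legSub i g) (D.legSub i h - D.legSub i g) else 0) =
      D.plainLegs (x + 2) := fun x hx => sum_congr rfl fun i _ => by
    have := D.sum_nested_pairIndicator i le_rfl (by omega : 2 ≤ x)
    simp only [and_true] at this
    rw [add_comm x 2]
    convert this
  have hlegs : ∀ x y, 3 ≤ x → 2 ≤ y → ∑ i, ∑ h ∈ range (D.size i), ∑ g ∈ range (D.size i),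
      (if g < h ∧ ¬ (D.fork i ∧ h = 1 ∧ g = 0)
        then pairIndicator x y (D.legSub i g) (D.legSub i h - D.legSub i g) else 0) =
      D.legs (x + y) := fun x y hx hy => sum_congr rfl fun i _ => by
    have := D.sum_nested_pairIndicator i (by omega : 2 ≤ x) hy
    simp only [show x ≠ 2 by omega, and_false, not_false_eq_true, and_true] at this
    convert this
  have hsplit : ∀ (p : Prop) [Decidable p] (a₁ a₂ a₃ a₄ a₅ a₆ : ℤ),
      (if p then a₁ + a₂ + (a₃ + a₄) + (a₅ + a₆) else 0) =
        (if p then a₁ else 0) + (if p then a₂ else 0) + ((if p then a₃ else 0) +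
          (if p then a₄ else 0)) + ((if p then a₅ else 0) + (if p then a₆ else 0)) := by
    intros
    split_ifs <;> simp
  simp only [tripleIndicator, hsplit, sum_add_distrib]
  rw [hplain b hb, hplain c hc, hlegs b 2 hb le_rfl, hlegs c 2 hc le_rfl,
    hlegs b c hb (by omega), hlegs c b hc (by omega), add_comm c b]
  ring

/-- Pairs on different legs are all pairs minus those on a common leg. A leg with subtrees of sizes
2 and `b` is a leg without fork of size at least `b`, which is where `plainLegs b` comes from. -/
theorem sum_incomparable_tripleIndicator [DecidableEq ι] (D : LegData ι) {b c : ℕ} (hb : 3 ≤ b)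
    (hc : 3 ≤ c) :
    ∑ i, ∑ j, (if i = j then 0 else ∑ h ∈ range (D.size i), ∑ g ∈ range (D.size j),
      tripleIndicator b c (D.legSub j g) (D.legSub i h)) =
      2 * (D.plainLegs 2 * D.legs b - D.plainLegs b + (D.plainLegs 2 * D.legs c - D.plainLegs c) +
        (D.legs b * D.legs c - D.legs (max b c))) := by
  have hsplit : ∀ (p : Prop) [Decidable p] (a₁ a₂ a₃ a₄ a₅ a₆ : ℤ),
      (if p then 0 else a₁ + a₂ + (a₃ + a₄) + (a₅ + a₆)) =
        (if p then 0 else a₁) + (if p then 0 else a₂) + ((if p then 0 else a₃) +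
          (if p then 0 else a₄)) + ((if p then 0 else a₅) + (if p then 0 else a₆)) := by
    intros
    split_ifs <;> simp
  have hcomm : ∀ x y, ∑ i, D.legCount i x * D.legCount i y =
      ∑ i, D.legCount i y * D.legCount i x := fun x y =>
    sum_congr rfl fun i _ => mul_comm _ _
  simp only [tripleIndicator, sum_add_distrib, sum_pairIndicator, hsplit, sum_ne_eq]
  rw [hcomm b 2, hcomm c 2, hcomm c b, D.sum_legCount_two_mul hb, D.sum_legCount_two_mul hc,
    D.sum_legCount_mul hb hc, D.sum_legCount_two, D.sum_legCount_of_three_le hb,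
    D.sum_legCount_of_three_le hc]
  ring

theorem sum_cuts_card_three [DecidableEq ι] (D : LegData ι) {b c : ℕ} (hb : 3 ≤ b) (hc : 3 ≤ c)
    (hbc : 2 + b + c = ∑ i, D.size i + 1) :
    ∑ C ∈ D.tree.cuts, (if Multiset.card (D.tree.type C) = 3 then
        ((D.tree.type C).count 2 : ℤ) * ((D.tree.type C).count b : ℤ) else 0) =
      (D.plainLegs (b + 2) + D.plainLegs (c + 2) + D.legs (b + 2) + D.legs (c + 2) +
        2 * D.legs (b + c)) +
      (D.plainLegs 2 * D.legs b - D.plainLegs b + (D.plainLegs 2 * D.legs c - D.plainLegs c) +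
        (D.legs b * D.legs c - D.legs (max b c))) := by
  classical
  have h3 := D.tree.sum_cuts_card_three fun l => (l.count 2 : ℤ) * (l.count b : ℤ)
  rw [D.tree.sum_offDiag_eq (fun l => (l.count 2 : ℤ) * (l.count b : ℤ)) (tripleIndicator b c)
    fun x y z h => count_mul_count_eq_tripleIndicator hb (by rw [h, card_eq, hbc])] at h3
  have hpair : ∀ i j, ∑ h : Fin (D.size i), ∑ g : Fin (D.size j),
      (2 * (if (some ⟨i, h⟩ : Option (Σ i, Fin (D.size i))) ≠ some ⟨j, g⟩ ∧
          D.tree.Below (some ⟨i, h⟩) (some ⟨j, g⟩) then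
          tripleIndicator b c (D.legSub j g) (D.legSub i h - D.legSub j g) else 0) +
        if ¬ D.tree.Below (some ⟨i, h⟩) (some ⟨j, g⟩) ∧
          ¬ D.tree.Below (some ⟨j, g⟩) (some ⟨i, h⟩) then
          tripleIndicator b c (D.legSub j g) (D.legSub i h) else 0) =
      (if i = j then 2 * ∑ h ∈ range (D.size i), ∑ g ∈ range (D.size i),
        (if g < h ∧ ¬ (D.fork i ∧ h = 1 ∧ g = 0)
          then tripleIndicator b c (D.legSub i g) (D.legSub i h - D.legSub i g) else 0) else 0) +
      if i = j then 0 else ∑ h ∈ range (D.size i), ∑ g ∈ range (D.size j),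
        tripleIndicator b c (D.legSub j g) (D.legSub i h) := by
    intro i j
    by_cases hij : i = j
    · subst hij
      rw [if_pos rfl, if_pos rfl, add_zero, ← sum_fin_fin, mul_sum]
      refine sum_congr rfl fun h _ => ?_
      rw [mul_sum]
      refine sum_congr rfl fun g _ => ?_
      simp only [below_some_some_iff, true_and, ne_eq, Option.some_inj, Sigma.mk.injEq, heq_eq_eq,
        Fin.ext_iff]
      -- Incomparable vertices of one leg are the two leaves of its fork; their subtrees have size
      -- 1, which is none of `2, b, c`.
      have hzero : (if ¬ ((g : ℕ) ≤ h ∧ ¬ (D.fork i ∧ (h : ℕ) = 1 ∧ (g : ℕ) = 0)) ∧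
          ¬ ((h : ℕ) ≤ g ∧ ¬ (D.fork i ∧ (g : ℕ) = 1 ∧ (h : ℕ) = 0)) then
          tripleIndicator b c (D.legSub i g) (D.legSub i h) else 0) = 0 := by
        split_ifs with hc'
        · have hf : D.fork i := by
            by_contra hf
            simp only [hf, false_and, not_false_eq_true, and_true] at hc'
            omega
          have h1 : D.legSub i g = 1 := by
            simp only [hf, true_and] at hc'
            simp only [legSub, hf, true_and]
            split_ifs <;> omega
          unfold tripleIndicator pairIndicator
          rw [h1]
          split_ifs <;> omega
        · rfl
      rw [hzero, add_zero]
      congr 1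
      refine if_congr ?_ rfl rfl
      by_cases hf : D.fork i
      · simp only [hf, true_and]
        omega
      · simp only [hf, false_and, not_false_eq_true, and_true]
        omega
    · rw [if_neg hij, if_neg hij, zero_add, ← sum_fin_fin]
      refine sum_congr rfl fun h _ => sum_congr rfl fun g _ => ?_
      simp [below_some_some_iff, hij, Ne.symm hij]
  simp only [D.sum_erase_root, sub_some] at h3
  rw [sum_congr rfl fun i _ => sum_comm] at h3
  simp only [hpair] at h3
  simp only [sum_add_distrib, sum_ite_eq, mem_univ, if_true, ← mul_sum] at h3
  rw [D.sum_nested_tripleIndicator hb hc, D.sum_incomparable_tripleIndicator hb hc, ← mul_add] at h3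
  exact mul_left_cancel₀ two_ne_zero h3

end LegData

/-! ### Recovering the legs -/

/-- At a first failure `j + 1`, the symmetric sum gives `f' (n - (j + 1)) ≥ 1`, and monotonicity
gives `f (j + 1) ≥ 2`, hence `f' j ≥ f j ≥ 2`. This is too much for arguments whose sum is `n - 1`.
-/
theorem le_of_symmetric_sums_eq {n : ℕ} {f f' : ℕ → ℤ} (hf : Antitone f) (hf' : Antitone f')
    (h0 : ∀ j, 0 ≤ f j) (h1 : f 1 = f' 1)
    (hsum : ∀ j, 1 ≤ j → j < n → f j + f (n - j) = f' j + f' (n - j))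
    (hlong : ∀ a b, n ≤ a + b + 1 → 1 ≤ f' a → f' b ≤ 1) (j : ℕ) (hj : 1 ≤ j) (hjn : 2 * j ≤ n) :
    f j ≤ f' j := by
  induction j, hj using Nat.le_induction with
  | base => exact h1.le
  | succ j hj ih =>
    have ih := ih (by omega)
    by_contra! hlt
    have h2 := hsum (j + 1) (by omega) (by omega)
    have h3 := h0 (n - (j + 1))
    have h4 : f' (n - (j + 1)) ≤ f' (j + 1) := hf' (by omega)
    have h5 := hlong (n - (j + 1)) j (by omega) (by omega)
    have h6 : f (j + 1) ≤ f j := hf (by omega)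
    omega

/-- A weakly decreasing sequence of a certain shape is determined by its symmetric sums. -/
theorem eq_of_symmetric_sums_eq {n : ℕ} {f f' : ℕ → ℤ} (hf : Antitone f) (hf' : Antitone f')
    (h0 : ∀ j, 0 ≤ f j) (h0' : ∀ j, 0 ≤ f' j) (h1 : f 1 = f' 1)
    (hsum : ∀ j, 1 ≤ j → j < n → f j + f (n - j) = f' j + f' (n - j))
    (hlong : ∀ a b, n ≤ a + b + 1 → 1 ≤ f a → f b ≤ 1)
    (hlong' : ∀ a b, n ≤ a + b + 1 → 1 ≤ f' a → f' b ≤ 1) (j : ℕ) (hj : 1 ≤ j) (hjn : j < n) :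
    f j = f' j := by
  have key : ∀ j, 1 ≤ j → 2 * j ≤ n → f j = f' j := fun j hj hjn =>
    le_antisymm (le_of_symmetric_sums_eq hf hf' h0 h1 hsum hlong' j hj hjn)
      (le_of_symmetric_sums_eq hf' hf h0' h1.symm (fun j h h' => (hsum j h h').symm) hlong j hj hjn)
  rcases le_total (2 * j) n with h | h
  · exact key j hj h
  · have h2 := hsum j hj hjn
    have h3 := key (n - j) (by omega) (by omega)
    omega

/-- Odd arguments lead back to `t 3`, and `t` is constant on even ones. The reflection `b ↦ n - b`
takes an even argument to an odd one, or to an even one with the opposite value. -/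
theorem antisymmetric_eq_zero {n : ℕ} {t : ℕ → ℤ} (h3 : t 3 = 0)
    (hstep : ∀ b, 3 ≤ b → b + 5 ≤ n → t b = t (b + 2))
    (hanti : ∀ b, b ≤ n → t (n - b) = - t b) (b : ℕ) (hb : 3 ≤ b) (hbn : b + 3 ≤ n) : t b = 0 := by
  have hodd : ∀ k, 3 + 2 * k + 3 ≤ n → t (3 + 2 * k) = 0 := by
    intro k
    induction k with
    | zero => exact fun _ => h3
    | succ k ih =>
      intro hk
      rw [← ih (by omega), hstep (3 + 2 * k) (by omega) (by omega)]
      rfl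
  have heven : ∀ k, 4 + 2 * k + 3 ≤ n → t (4 + 2 * k) = t 4 := by
    intro k
    induction k with
    | zero => exact fun _ => rfl
    | succ k ih =>
      intro hk
      rw [← ih (by omega), hstep (4 + 2 * k) (by omega) (by omega)]
      rfl
  rcases Nat.even_or_odd' b with ⟨k, rfl | rfl⟩
  · have h1 := heven (k - 2) (by omega)
    rw [show 4 + 2 * (k - 2) = 2 * k by omega] at h1
    have h2 := hanti (2 * k) (by omega)
    rcases Nat.even_or_odd' n with ⟨m, rfl | rfl⟩
    · have h4 := heven (m - k - 2) (by omega)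
      rw [show 4 + 2 * (m - k - 2) = 2 * m - 2 * k by omega] at h4
      omega
    · have h4 := hodd (m - k - 1) (by omega)
      rw [show 3 + 2 * (m - k - 1) = 2 * m + 1 - 2 * k by omega] at h4
      omega
  · have h1 := hodd (k - 1) (by omega)
    rwa [show 3 + 2 * (k - 1) = 2 * k + 1 by omega] at h1

/-- Two sequences that are dominated by the same sequence, of the shape considered above, agree if
their differences satisfy a certain recurrence. -/
theorem eq_of_recurrence {n : ℕ} (hn : 4 ≤ n) {N u u' : ℕ → ℤ} (hu : Antitone u)
    (hu' : Antitone u') (hNu : Antitone (N - u)) (hNu' : Antitone (N - u')) (h0 : ∀ j, 0 ≤ u j)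
    (h0' : ∀ j, 0 ≤ u' j) (hle : ∀ j, u j ≤ N j) (hle' : ∀ j, u' j ≤ N j)
    (hsmall : ∀ j, 1 ≤ j → j ≤ 3 → u j = u' j) (hN : N (n - 2) = 0)
    (hlong : ∀ a b, n ≤ a + b + 1 → 1 ≤ N a → N b ≤ 1)
    (hrec : ∀ b c, 3 ≤ b → 3 ≤ c → 2 + b + c = n →
      u (b + 2) + u (c + 2) - u b - u c = u' (b + 2) + u' (c + 2) - u' b - u' c)
    (j : ℕ) (hj : 1 ≤ j) : u j = u' j := by
  classical
  have hNanti : Antitone N := by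
    intro x y hxy
    have h1 := hu hxy
    have h2 := hNu hxy
    simp only [Pi.sub_apply] at h2
    omega
  have hlarge : ∀ j, n - 2 ≤ j → u j = u' j := fun j hj => by
    have h1 := hNanti hj
    have h2 := h0 j
    have h3 := h0' j
    have h4 := hle j
    have h5 := hle' j
    omega
  have key : ∀ j, n ≤ 2 * j → u j ≠ u' j →
      ∃ b, 2 ≤ b ∧ b + j + 1 ≤ n ∧ u b ≠ u' b ∧ u (n - b) = u' (n - b) := by
    intro j hj hne
    have hNj : 1 ≤ N j := by
      have h2 := h0 j
      have h3 := h0' j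
      have h4 := hle j
      have h5 := hle' j
      omega
    have hjn : j < n - 2 := by
      by_contra! h
      exact hne (hlarge j h)
    -- `M` is the last argument where `N` is positive. On `[n - 1 - M, M]` we have `N = 1` by
    -- `hlong`; as `u` and `N - u` both decrease, `u` is constant there, and likewise `u'`.
    have hex : ∃ M, N (M + 1) ≤ 0 ∧ j ≤ M := ⟨n - 3, by rw [show n - 3 + 1 = n - 2 by omega, hN],
      by omega⟩
    obtain ⟨hM1, hjM⟩ := Nat.find_spec hex
    have hMmin := fun m hm => Nat.find_min hex (m := m) hm
    set M := Nat.find hex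
    have hM : 1 ≤ N M := by
      rcases eq_or_lt_of_le hjM with h | h
      · rwa [← h]
      · have := hMmin (M - 1) (by omega)
        rw [show M - 1 + 1 = M by omega] at this
        by_contra! h'
        exact this ⟨by omega, by omega⟩
    have hMn : M < n - 2 := by
      by_contra! h
      have := hNanti h
      omega
    have hbj : n - 1 - M ≤ j := by omega
    have h1 := hlong M (n - 1 - M) (by omega) hM
    have h2 := hu hbj
    have h3 := hu' hbj
    have h4 := hNu hbj
    have h5 := hNu' hbj
    simp only [Pi.sub_apply] at h4 h5
    refine ⟨n - 1 - M, by omega, by omega, by omega, ?_⟩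
    rw [show n - (n - 1 - M) = M + 1 by omega]
    have h6 := h0 (M + 1)
    have h7 := h0' (M + 1)
    have h8 := hle (M + 1)
    have h9 := hle' (M + 1)
    omega
  -- For `j = n - 3` the bounds in `key` leave only `b = 2`, where agreement is known.
  have hthree : u (n - 3) = u' (n - 3) := by
    rcases le_or_gt (n - 3) 3 with h | h
    · exact hsmall _ (by omega) h
    · by_contra hne
      obtain ⟨b, hb2, hbn, hb, -⟩ := key (n - 3) (by omega) hne
      exact hb (hsmall b (by omega) (by omega))
  -- With `d = u - u'`, the recurrence says that `d b - d (n - b)` has period 2 in `b`; it changes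
  -- sign under reflection and vanishes at 3 by `hthree`.
  have hsymm : ∀ b, 3 ≤ b → b + 3 ≤ n → u b - u' b = u (n - b) - u' (n - b) := by
    intro b hb hbn
    have := antisymmetric_eq_zero (n := n) (t := fun b => (u b - u' b) - (u (n - b) - u' (n - b)))
      ?_ ?_ ?_ b hb hbn
    · omega
    · have := hsmall 3 (by omega) le_rfl
      omega
    · intro b hb hbn
      have := hrec b (n - 2 - b) hb (by omega) (by omega)
      rw [show n - b = n - 2 - b + 2 by omega, show n - (b + 2) = n - 2 - b by omega]
      omega
    · intro b hbn
      rw [Nat.sub_sub_self hbn]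
      ring
  have hhalf : ∀ j, 1 ≤ j → n ≤ 2 * j → u j = u' j := by
    intro j hj hjn
    by_contra hne
    obtain ⟨b, hb2, hbn, hb, hb'⟩ := key j hjn hne
    rcases le_or_gt b 3 with h | h
    · exact hb (hsmall b (by omega) h)
    · have := hsymm b (by omega) (by omega)
      omega
  rcases le_or_gt n (2 * j) with h | h
  · exact hhalf j hj h
  rcases le_or_gt j 3 with h' | h'
  · exact hsmall j hj h'
  · have h1 := hsymm j (by omega) (by omega)
    have h2 := hhalf (n - j) (by omega) (by omega)
    omega

/-! ### Comparison of two 2-spiders -/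

namespace LegData

variable {ι κ : Type*} [Fintype ι] [Fintype κ]

theorem legs_antitone (D : LegData ι) : Antitone D.legs := fun x y hxy =>
  sum_le_sum fun i _ => by split_ifs <;> omega

theorem plainLegs_antitone (D : LegData ι) : Antitone D.plainLegs := fun x y hxy =>
  sum_le_sum fun i _ => by
    by_cases hf : D.fork i <;> simp only [hf, not_true, not_false_eq_true, and_true, and_false]
    · exact le_rfl
    · split_ifs <;> omega

theorem legs_sub_plainLegs (D : LegData ι) [DecidablePred D.fork] (x : ℕ) :
    D.legs x - D.plainLegs x = ∑ i, if x ≤ D.size i ∧ D.fork i then 1 else 0 := by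
  rw [legs, plainLegs, ← sum_sub_distrib]
  refine sum_congr rfl fun i _ => ?_
  by_cases hf : D.fork i <;> simp [hf]

theorem legs_sub_plainLegs_antitone (D : LegData ι) : Antitone (D.legs - D.plainLegs) := by
  classical
  intro x y hxy
  rw [Pi.sub_apply, Pi.sub_apply, legs_sub_plainLegs, legs_sub_plainLegs]
  refine sum_le_sum fun i _ => ?_
  by_cases hf : D.fork i <;> simp only [hf, and_true, and_false]
  · split_ifs <;> omega
  · exact le_rfl

theorem legs_sub_plainLegs_of_le_three (D : LegData ι) {x : ℕ} (hx : x ≤ 3) :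
    D.legs x - D.plainLegs x = D.forks := by
  classical
  rw [legs_sub_plainLegs]
  refine sum_congr rfl fun i _ => ?_
  by_cases hf : D.fork i
  · have := D.three_le_size i hf
    rw [if_pos ⟨by omega, hf⟩, if_pos hf]
  · simp [hf]

theorem plainLegs_nonneg (D : LegData ι) (x : ℕ) : 0 ≤ D.plainLegs x :=
  sum_nonneg fun i _ => by split_ifs <;> omega

theorem plainLegs_le_legs (D : LegData ι) (x : ℕ) : D.plainLegs x ≤ D.legs x := by
  classical
  rw [← sub_nonneg, legs_sub_plainLegs]
  exact sum_nonneg fun i _ => by split_ifs <;> omega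

theorem legs_nonneg (D : LegData ι) (x : ℕ) : 0 ≤ D.legs x :=
  sum_nonneg fun i _ => by split_ifs <;> omega

theorem legs_one (D : LegData ι) : D.legs 1 = Fintype.card ι := by
  have h : ∀ i, 1 ≤ D.size i := D.size_pos
  simp [legs, h]

theorem legs_zero (D : LegData ι) : D.legs 0 = Fintype.card ι := by
  simp [legs]

theorem exists_le_size_of_legs_pos (D : LegData ι) {x : ℕ} (h : 1 ≤ D.legs x) :
    ∃ i, x ≤ D.size i := by
  by_contra! hlt
  rw [legs, sum_eq_zero fun i _ => if_neg (hlt i).not_ge] at h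
  omega

/-- Two different legs with at least `a` and `b` vertices would use up all available vertices and
leave none for a third leg. -/
theorem legs_le_one (D : LegData ι) (hD : 3 ≤ Fintype.card ι) {a b : ℕ}
    (hab : ∑ i, D.size i ≤ a + b) (ha : 1 ≤ D.legs a) : D.legs b ≤ 1 := by
  classical
  obtain ⟨i, hi⟩ := D.exists_le_size_of_legs_pos ha
  have hother : ∀ j ∈ univ.erase i, D.size j < b := by
    intro j hj
    replace hj := ne_of_mem_erase hj
    by_contra! hjb
    obtain ⟨k, -, hk⟩ := exists_mem_notMem_of_card_lt_card
      (show #({i, j} : Finset ι) < #(univ : Finset ι) by rw [card_univ, card_pair hj.symm]; omega)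
    simp only [mem_insert, mem_singleton, not_or] at hk
    have h1 : ∑ l ∈ {i, j, k}, D.size l ≤ ∑ l, D.size l :=
      sum_le_sum_of_subset (subset_univ _)
    rw [sum_insert (by simp [hj.symm, Ne.symm hk.1]), sum_pair (Ne.symm hk.2)] at h1
    have := D.size_pos k
    omega
  rw [legs, ← add_sum_erase _ _ (mem_univ i),
    sum_eq_zero fun j hj => if_neg (hother j hj).not_ge]
  split_ifs <;> simp

theorem legs_eq_zero (D : LegData ι) (hD : 3 ≤ Fintype.card ι) {x : ℕ}
    (hx : ∑ i, D.size i ≤ x + 1) : D.legs x = 0 := by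
  by_contra hne
  have h1 := D.legs_le_one hD (a := x) (b := 1) hx (by have := D.legs_nonneg x; omega)
  rw [legs_one] at h1
  omega

theorem three_le_sum_size (D : LegData ι) (hD : 3 ≤ Fintype.card ι) : 3 ≤ ∑ i, D.size i := by
  have : ∑ i : ι, 1 ≤ ∑ i, D.size i := sum_le_sum fun i _ => D.size_pos i
  rw [sum_const, card_univ, smul_eq_mul, mul_one] at this
  omega

/-- Each fork replaces one subtree of size 2 by one of size 1, whence the corrections at these two
sizes. -/
theorem sum_legCount_add (D : LegData ι) {j : ℕ} (hj : 1 ≤ j)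
    (hjn : j ≤ ∑ i, D.size i) :
    ∑ i, D.legCount i j + ∑ i, D.legCount i (∑ i, D.size i + 1 - j) =
      D.legs j + D.legs (∑ i, D.size i + 1 - j) +
        ((if j = 1 then D.forks else 0) - (if j = 2 then D.forks else 0) +
        ((if ∑ i, D.size i + 1 - j = 1 then D.forks else 0) -
          if ∑ i, D.size i + 1 - j = 2 then D.forks else 0)) := by
  have key : ∀ x, 1 ≤ x → ∑ i, D.legCount i x = D.legs x +
      ((if x = 1 then D.forks else 0) - if x = 2 then D.forks else 0) := by
    intro x hx
    rcases Nat.lt_or_ge x 3 with h | h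
    · interval_cases x
      · rw [sum_legCount_one, legs_one]
        simp
      · have := D.legs_sub_plainLegs_of_le_three (x := 2) (by omega)
        rw [sum_legCount_two]
        simp only [OfNat.ofNat_ne_one, if_false, if_true]
        omega
    · rw [D.sum_legCount_of_three_le h, if_neg (by omega), if_neg (by omega)]
      ring
  rw [key j hj, key _ (by omega)]
  ring

theorem card_plain_fiber (F : LegData ι) [DecidableEq (ℕ × Prop)] (x : ℕ) :
    (#{i | (F.size i, F.fork i) = (x, False)} : ℤ) = F.plainLegs x - F.plainLegs (x + 1) := by
  rw [plainLegs, plainLegs, ← sum_sub_distrib, card_filter]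
  push_cast
  refine sum_congr rfl fun i _ => ?_
  by_cases hf : F.fork i
  · simp [hf]
  · simp only [hf, Prod.mk.injEq, and_true, not_false_eq_true]
    split_ifs <;> omega

theorem card_fork_fiber (F : LegData ι) [DecidableEq (ℕ × Prop)] (x : ℕ) :
    (#{i | (F.size i, F.fork i) = (x, True)} : ℤ) =
      (F.legs x - F.plainLegs x) - (F.legs (x + 1) - F.plainLegs (x + 1)) := by
  classical
  rw [legs_sub_plainLegs, legs_sub_plainLegs, ← sum_sub_distrib, card_filter]
  push_cast
  refine sum_congr rfl fun i _ => ?_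
  by_cases hf : F.fork i
  · simp only [hf, Prod.mk.injEq, and_true]
    split_ifs <;> omega
  · simp [hf]

/-- The numbers of legs of each size, with or without fork, are successive differences of the two
counting functions. -/
theorem exists_equiv_of_legs_eq (D : LegData ι) (E : LegData κ)
    (h : ∀ x, 1 ≤ x → D.legs x = E.legs x) (h' : ∀ x, 1 ≤ x → D.plainLegs x = E.plainLegs x) :
    ∃ e : ι ≃ κ, ∀ i, E.size (e i) = D.size i ∧ (E.fork (e i) ↔ D.fork i) := by
  classical
  have hfiber : ∀ c : ℕ × Prop, #{i | (D.size i, D.fork i) = c} =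
      #{i | (E.size i, E.fork i) = c} := by
    rintro ⟨x, p⟩
    rcases Nat.eq_zero_or_pos x with rfl | hx
    · rw [card_eq_zero.2, card_eq_zero.2]
      · exact filter_eq_empty_iff.2 fun i _ hi =>
          (E.size_pos i).ne' (congrArg Prod.fst hi)
      · exact filter_eq_empty_iff.2 fun i _ hi =>
          (D.size_pos i).ne' (congrArg Prod.fst hi)
    · apply Nat.cast_injective (R := ℤ)
      by_cases hp : p
      · rw [eq_true hp, D.card_fork_fiber x, E.card_fork_fiber x, h x hx, h' x hx,
          h _ (by omega), h' _ (by omega)]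
      · rw [eq_false hp, D.card_plain_fiber x, E.card_plain_fiber x, h' x hx, h' _ (by omega)]
  obtain ⟨e, he⟩ := exists_equiv_of_card_fiber_eq _ _ hfiber
  refine ⟨e, fun i => ?_⟩
  have := he i
  rw [Prod.mk.injEq] at this
  exact ⟨this.1, this.2 ▸ Iff.rfl⟩

theorem exists_equiv_of_chromaticSymmetricFunction_eq (D : LegData ι) (E : LegData κ)
    (hD : 3 ≤ Fintype.card ι) (hE : 3 ≤ Fintype.card κ)
    (h : D.tree.graph.chromaticSymmetricFunction = E.tree.graph.chromaticSymmetricFunction) :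
    ∃ e : ι ≃ κ, ∀ i, E.size (e i) = D.size i ∧ (E.fork (e i) ↔ D.fork i) := by
  classical
  have hcard := D.tree.card_eq_of_chromaticSymmetricFunction_eq E.tree.graph h
  rw [card_eq, card_eq, Nat.add_right_cancel_iff] at hcard
  have hn := D.three_le_sum_size hD
  have htype := D.tree.sum_type_eq E.tree h
  have hsum : ∀ j, 1 ≤ j → j ≤ ∑ i, D.size i → _ := fun j h1 h2 => by
    have h3 := htype fun l => if Multiset.card l = 2 then (l.count j : ℤ) else 0
    rw [D.sum_cuts_card_two h2, E.sum_cuts_card_two (by omega), D.sum_legCount_add h1 h2,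
      E.sum_legCount_add h1 (by omega), ← hcard] at h3
    exact h3
  have hroot : (Fintype.card ι : ℤ) = Fintype.card κ ∧ D.forks = E.forks := by
    have h1 := htype fun l => if Multiset.card l = ∑ i, D.size i + 1 - 2 ∧ 3 ∈ l then 1 else 0
    have hD3 := D.sum_cuts_three_mem (by omega)
    have hE3 := E.sum_cuts_three_mem (by omega)
    rw [← hcard] at hE3
    rw [h1, hE3] at hD3
    have h2 := hsum 1 le_rfl (by omega)
    rw [D.legs_one, E.legs_one, D.legs_eq_zero hD (by omega), E.legs_eq_zero hE (by omega),
      if_pos rfl, if_pos rfl, if_neg (by omega), if_neg (by omega), if_neg (by omega),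
      if_neg (by omega), if_neg (by omega), if_neg (by omega)] at h2
    -- For `k` legs and `f` forks, both `k + f` and `k² - 3k + 2f` agree, hence so does `k² - 5k`;
    -- the second factor is positive because there are at least three legs on each side.
    have h3 : ((Fintype.card ι : ℤ) - Fintype.card κ) *
        (Fintype.card ι + Fintype.card κ - 5) = 0 := by
      linear_combination (-1 : ℤ) * hD3 - 2 * h2
    rcases mul_eq_zero.1 h3 with h3 | h3 <;> constructor <;> omega
  have hlegs : ∀ x, 1 ≤ x → D.legs x = E.legs x := by
    intro x hx
    rcases Nat.lt_or_ge (∑ i, D.size i) x with hlt | hle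
    · rw [D.legs_eq_zero hD (by omega), E.legs_eq_zero hE (by omega)]
    refine eq_of_symmetric_sums_eq (n := ∑ i, D.size i + 1) D.legs_antitone E.legs_antitone
      D.legs_nonneg E.legs_nonneg ?_ (fun j h1 h2 => ?_)
      (fun a b hab => D.legs_le_one hD (by omega)) (fun a b hab => E.legs_le_one hE (by omega)) x hx
      (by omega)
    · rw [legs_one, legs_one, hroot.1]
    · have := hsum j h1 (by omega)
      rw [hroot.2] at this
      exact add_right_cancel this
  refine D.exists_equiv_of_legs_eq E hlegs fun x hx => ?_
  have hfun : E.legs = D.legs := by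
    funext x
    rcases Nat.eq_zero_or_pos x with rfl | hx
    exacts [by rw [legs_zero, legs_zero, hroot.1], (hlegs x hx).symm]
  refine eq_of_recurrence (n := ∑ i, D.size i + 1) (N := D.legs) (by omega)
    D.plainLegs_antitone E.plainLegs_antitone D.legs_sub_plainLegs_antitone
    (hfun ▸ E.legs_sub_plainLegs_antitone) D.plainLegs_nonneg E.plainLegs_nonneg
    D.plainLegs_le_legs (hfun ▸ E.plainLegs_le_legs) ?_ (D.legs_eq_zero hD (by omega))
    (fun a b hab => D.legs_le_one hD (by omega)) ?_ x hx
  · intro j h1 h3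
    have e1 := D.legs_sub_plainLegs_of_le_three h3
    have e2 := E.legs_sub_plainLegs_of_le_three h3
    rw [hfun, ← hroot.2] at e2
    omega
  · intro b c hb hc hbc
    have h3 := htype fun l => if Multiset.card l = 3 then
      (l.count 2 : ℤ) * (l.count b : ℤ) else 0
    rw [D.sum_cuts_card_three hb hc hbc, E.sum_cuts_card_three hb hc (by omega), hfun] at h3
    have e1 := D.legs_sub_plainLegs_of_le_three (x := 2) (by omega)
    have e2 := E.legs_sub_plainLegs_of_le_three (x := 2) (by omega)
    rw [hfun, ← hroot.2] at e2
    have e3 : E.plainLegs 2 = D.plainLegs 2 := by omega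
    rw [e3] at h3
    -- All terms in `legs` and `plainLegs 2` now coincide and cancel, leaving the recurrence for
    -- `plainLegs`.
    linear_combination h3

end LegData

/-! ### The structure of 2-spiders -/

namespace SimpleGraph

variable {V : Type*}

/-- Geodesics to `w` and `w'` extend to paths to `v`; these coincide, and with them their
penultimate vertices. -/
theorem IsTree.eq_of_adj_of_dist {G : SimpleGraph V} (hG : G.IsTree) {t v w w' : V}
    (hw : G.Adj w v) (hw' : G.Adj w' v) (h : G.dist t v = G.dist t w + 1)
    (h' : G.dist t v = G.dist t w' + 1) : w = w' := by
  obtain ⟨p, hp⟩ := hG.connected.exists_walk_length_eq_dist t w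
  obtain ⟨q, hq⟩ := hG.connected.exists_walk_length_eq_dist t w'
  have h1 : (p.concat hw).IsPath := Walk.isPath_of_length_eq_dist _ (by
    rw [Walk.length_concat, hp, h])
  have h2 : (q.concat hw').IsPath := Walk.isPath_of_length_eq_dist _ (by
    rw [Walk.length_concat, hq, h'])
  have h3 := congrArg Subtype.val ((hG.isAcyclic.subsingleton_path t v).elim ⟨_, h1⟩ ⟨_, h2⟩)
  have h4 := congrArg Walk.penultimate h3
  simpa using h4

theorem IsTree.exists_adj_dist {G : SimpleGraph V} (hG : G.IsTree) {t v : V} (hv : v ≠ t) :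
    ∃ w, G.Adj w v ∧ G.dist t v = G.dist t w + 1 := by
  obtain ⟨p, hp⟩ := hG.connected.exists_walk_length_eq_dist t v
  have hnil : ¬ p.Nil := fun h => hv h.eq.symm
  have hadj := p.adj_penultimate hnil
  refine ⟨p.penultimate, hadj, ?_⟩
  have h1 := hG.dist_eq_dist_add_one_of_adj t hadj
  have h2 := G.dist_le p.dropLast
  have h3 : p.dropLast.length + 1 = p.length := by
    conv_rhs => rw [← p.concat_dropLast (hp := hadj)]
    rw [Walk.length_concat]
  omega

theorem IsTree.exists_parent {G : SimpleGraph V} (hG : G.IsTree) (t : V) :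
    ∃ par : V → V, (∀ v, v ≠ t → G.dist t v = G.dist t (par v) + 1) ∧
      ∀ v w, G.Adj v w ↔ (v ≠ t ∧ par v = w) ∨ (w ≠ t ∧ par w = v) := by
  have h : ∀ v, ∃ w, v ≠ t → G.Adj w v ∧ G.dist t v = G.dist t w + 1 := by
    intro v
    by_cases hv : v = t
    · exact ⟨t, fun h => absurd hv h⟩
    · obtain ⟨w, hw⟩ := hG.exists_adj_dist hv
      exact ⟨w, fun _ => hw⟩
  choose par hpar using h
  have key : ∀ v w, G.Adj v w → G.dist t v = G.dist t w + 1 → v ≠ t ∧ par v = w := by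
    intro v w hadj hd
    have hv : v ≠ t := by
      rintro rfl
      rw [dist_self] at hd
      omega
    exact ⟨hv, hG.eq_of_adj_of_dist (hpar v hv).1 hadj.symm (hpar v hv).2 hd⟩
  refine ⟨par, fun v hv => (hpar v hv).2, fun v w => ⟨fun hadj => ?_, ?_⟩⟩
  · rcases hG.dist_eq_dist_add_one_of_adj t hadj with h | h
    · exact Or.inl (key v w hadj h)
    · exact Or.inr (key w v hadj.symm h)
  · rintro (⟨hv, rfl⟩ | ⟨hw, rfl⟩)
    · exact (hpar v hv).1.symm
    · exact (hpar w hw).1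

end SimpleGraph

/-- A rooted tree in which every vertex other than the root has at most one child. -/
structure LegTree (V : Type*) where
  root : V
  parent : V → V
  depth : V → ℕ
  depth_root : depth root = 0
  depth_eq : ∀ v, v ≠ root → depth v = depth (parent v) + 1
  parent_inj : ∀ v w, v ≠ root → w ≠ root → parent v = parent w → parent v ≠ root → v = w

namespace LegTree

variable {V : Type*} (T : LegTree V)

theorem ne_root_iff {v : V} : v ≠ T.root ↔ 0 < T.depth v := by
  constructor
  · intro h
    rw [T.depth_eq v h]
    omega
  · rintro h rfl
    rw [T.depth_root] at h
    omega

theorem depth_iterate (k : ℕ) (v : V) (hk : k ≤ T.depth v) :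
    T.depth (T.parent^[k] v) = T.depth v - k := by
  induction k with
  | zero => rfl
  | succ k ih =>
    rw [Function.iterate_succ_apply']
    have h := ih (by omega)
    have h' := T.depth_eq (T.parent^[k] v) (T.ne_root_iff.2 (by omega))
    omega

/-- The vertex next to the root on the way from `v` to the root. -/
def foot (v : V) : V := T.parent^[T.depth v - 1] v

theorem depth_foot {v : V} (hv : v ≠ T.root) : T.depth (T.foot v) = 1 := by
  have := T.ne_root_iff.1 hv
  rw [foot, T.depth_iterate _ _ (by omega)]
  omega

theorem foot_iterate {k : ℕ} {v : V} (hk : k < T.depth v) : T.foot (T.parent^[k] v) = T.foot v := by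
  rw [foot, foot, ← Function.iterate_add_apply, T.depth_iterate _ _ hk.le]
  congr 2
  omega

theorem foot_parent {v : V} (hv : T.parent v ≠ T.root) (hv' : v ≠ T.root) :
    T.foot (T.parent v) = T.foot v := by
  have h1 := T.ne_root_iff.1 hv
  have h2 := T.depth_eq v hv'
  exact T.foot_iterate (k := 1) (by omega)

theorem eq_of_iterate_eq {k : ℕ} {v w : V} (hv : k < T.depth v) (hd : T.depth v = T.depth w)
    (h : T.parent^[k] v = T.parent^[k] w) : v = w := by
  induction k generalizing v w with
  | zero => exact h
  | succ k ih =>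
    have hv' := T.ne_root_iff.2 (by omega : 0 < T.depth v)
    have hw' := T.ne_root_iff.2 (by omega : 0 < T.depth w)
    have h1 := T.depth_eq v hv'
    have h2 := T.depth_eq w hw'
    refine T.parent_inj v w hv' hw' (ih (by omega) (by omega) h) ?_
    rw [T.ne_root_iff]
    omega

/-- Each leg is a path: away from the root the parent map is injective, so a leg has at most one
vertex of each depth. -/
theorem eq_of_foot_eq {v w : V} (hv : v ≠ T.root) (hd : T.depth v = T.depth w)
    (h : T.foot v = T.foot w) : v = w := by
  have := T.ne_root_iff.1 hv
  refine T.eq_of_iterate_eq (k := T.depth v - 1) (by omega) hd ?_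
  rw [foot, foot, ← hd] at h
  exact h

theorem foot_of_depth_eq_one {v : V} (hv : T.depth v = 1) : T.foot v = v := by
  rw [foot, hv]
  rfl

theorem twin_ne_root {A : Set V} (hA : ∀ a ∈ A, 2 ≤ T.depth a) (a : A) : (a : V) ≠ T.root :=
  T.ne_root_iff.2 (by have := hA a a.2; omega)

variable [Fintype V]

open Classical in
/-- The largest depth of a vertex in the leg with foot `u`. -/
noncomputable def legDepth (u : V) : ℕ := ({v | v ≠ T.root ∧ T.foot v = u} : Finset V).sup T.depth

theorem depth_le_legDepth {v : V} (hv : v ≠ T.root) : T.depth v ≤ T.legDepth (T.foot v) := by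
  classical
  exact le_sup (f := T.depth) (mem_filter.2 ⟨mem_univ v, hv, rfl⟩)

theorem exists_depth_eq {u : V} (hu : T.depth u = 1) {d : ℕ} (hd : 1 ≤ d)
    (hd' : d ≤ T.legDepth u) : ∃ v, v ≠ T.root ∧ T.foot v = u ∧ T.depth v = d := by
  classical
  have hne : ({v | v ≠ T.root ∧ T.foot v = u} : Finset V).Nonempty :=
    ⟨u, mem_filter.2 ⟨mem_univ u, T.ne_root_iff.2 (by omega), T.foot_of_depth_eq_one hu⟩⟩
  obtain ⟨v, hv, hmax⟩ := exists_mem_eq_sup _ hne T.depth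
  rw [mem_filter] at hv
  have hmax' : T.legDepth u = T.depth v := by
    rw [← hmax, legDepth]
  have hdepth := T.depth_iterate (T.depth v - d) v (by omega)
  refine ⟨T.parent^[T.depth v - d] v, T.ne_root_iff.2 (by omega), ?_, by omega⟩
  rw [T.foot_iterate (by omega), hv.2.2]

/-- The depth of a leaf is the length of its leg. -/
theorem depth_eq_legDepth_of_leaf {a : V} (ha : a ≠ T.root)
    (hleaf : ∀ v, v ≠ T.root → T.parent v ≠ a) : T.depth a = T.legDepth (T.foot a) := by
  refine le_antisymm (T.depth_le_legDepth ha) ?_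
  by_contra! hlt
  have h0 := T.ne_root_iff.1 ha
  obtain ⟨v, hv, hfoot, hd⟩ := T.exists_depth_eq (T.depth_foot ha) (d := T.depth a + 1) (by omega) hlt
  have h1 := T.depth_eq v hv
  have hp : T.parent v ≠ T.root := T.ne_root_iff.2 (by omega)
  refine hleaf v hv (T.eq_of_foot_eq hp (by omega) ?_)
  rw [T.foot_parent hp hv, hfoot]

/-- The vertices next to the root. -/
abbrev Foot := {u : V // T.depth u = 1}

open Classical in
/-- The legs of the tree, extended by a fork at each of the leaves in `A`. -/
noncomputable def legData (A : Set V) (hA : ∀ a ∈ A, 2 ≤ T.depth a) : LegData T.Foot where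
  size u := T.legDepth u + if ∃ a ∈ A, T.foot a = u then 1 else 0
  fork u := ∃ a ∈ A, T.foot a = u
  size_pos u := by
    have := T.depth_le_legDepth (v := u.1) (T.ne_root_iff.2 (by rw [u.2]; exact one_pos))
    rw [T.foot_of_depth_eq_one u.2, u.2] at this
    omega
  three_le_size u h := by
    rw [if_pos h]
    obtain ⟨a, ha, hau⟩ := h
    have h2 := hA a ha
    have := T.depth_le_legDepth (T.ne_root_iff.2 (by omega : 0 < T.depth a))
    rw [hau] at this
    omega

end LegTree

/-! ### Coordinates on a spider with attached vertices -/

namespace LegTree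

variable {V : Type*} (T : LegTree V) [Fintype V] (A : Set V) (hA : ∀ a ∈ A, 2 ≤ T.depth a)

theorem size_legData_of_fork {u : T.Foot} (h : (T.legData A hA).fork u) :
    (T.legData A hA).size u = T.legDepth u + 1 := by
  unfold legData at h ⊢
  exact congrArg (T.legDepth u + ·) (if_pos h)

theorem size_legData_of_not_fork {u : T.Foot} (h : ¬ (T.legData A hA).fork u) :
    (T.legData A hA).size u = T.legDepth u := by
  unfold legData at h ⊢
  exact congrArg (T.legDepth u + ·) (if_neg h)

theorem legDepth_le_size (u : T.Foot) : T.legDepth u ≤ (T.legData A hA).size u := by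
  by_cases h : (T.legData A hA).fork u
  · rw [T.size_legData_of_fork A hA h]
    omega
  · rw [T.size_legData_of_not_fork A hA h]

/-- The foot of the leg of a vertex. -/
def legFoot (v : V) (hv : v ≠ T.root) : T.Foot := ⟨T.foot v, T.depth_foot hv⟩

theorem depth_le_size {v : V} (hv : v ≠ T.root) :
    T.depth v ≤ (T.legData A hA).size (T.legFoot v hv) :=
  (T.depth_le_legDepth hv).trans (T.legDepth_le_size A hA (T.legFoot v hv))

open Classical in
/-- The position of a vertex in the 2-spider with the legs of the tree. -/
noncomputable def position :
    V ⊕ A → Option (Σ u : T.Foot, Fin ((T.legData A hA).size u))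
  | .inl v => if hv : v = T.root then none else
      some ⟨T.legFoot v hv, ⟨(T.legData A hA).size (T.legFoot v hv) - T.depth v, by
        have h1 := T.depth_le_size A hA hv
        have h2 := T.ne_root_iff.1 hv
        omega⟩⟩
  | .inr a => some ⟨T.legFoot a (T.twin_ne_root hA a), ⟨0, LegData.size_pos _ _⟩⟩

theorem position_root : T.position A hA (.inl T.root) = none := dif_pos rfl

theorem position_inl {v : V} (hv : v ≠ T.root) : ∃ h : Fin _, T.position A hA (.inl v) =
    some ⟨T.legFoot v hv, h⟩ ∧
      (h : ℕ) + T.depth v = (T.legData A hA).size (T.legFoot v hv) :=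
  ⟨_, dif_neg hv, Nat.sub_add_cancel (T.depth_le_size A hA hv)⟩

theorem position_inr (a : A) : ∃ h : Fin _, T.position A hA (.inr a) =
    some ⟨T.legFoot a (T.twin_ne_root hA a), h⟩ ∧ (h : ℕ) = 0 :=
  ⟨_, rfl, rfl⟩

theorem fork_legFoot (a : A) :
    (T.legData A hA).fork (T.legFoot a (T.twin_ne_root hA a)) := ⟨a, a.2, rfl⟩

theorem lt_size_of_fork {v : V} (hv : v ≠ T.root)
    (h : (T.legData A hA).fork (T.legFoot v hv)) :
    T.depth v < (T.legData A hA).size (T.legFoot v hv) := by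
  rw [T.size_legData_of_fork A hA h]
  exact Nat.lt_succ_of_le (T.depth_le_legDepth hv)

/-- This places the old leaf `a` at position 1, leaving position 0 to its twin. -/
theorem depth_twin_add_one (hleaf : ∀ a ∈ A, ∀ v, v ≠ T.root → T.parent v ≠ a) (a : A) :
    T.depth a + 1 = (T.legData A hA).size (T.legFoot a (T.twin_ne_root hA a)) := by
  rw [T.size_legData_of_fork A hA (T.fork_legFoot A hA a),
    T.depth_eq_legDepth_of_leaf (T.twin_ne_root hA a) (hleaf a a.2)]
  rfl

theorem position_injective (hleaf : ∀ a ∈ A, ∀ v, v ≠ T.root → T.parent v ≠ a) :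
    Function.Injective (T.position A hA) := by
  have hsome : ∀ {i j : T.Foot} {h : Fin ((T.legData A hA).size i)}
      {g : Fin ((T.legData A hA).size j)},
      (some ⟨i, h⟩ : Option (Σ u : T.Foot, Fin ((T.legData A hA).size u))) = some ⟨j, g⟩ →
        i = j ∧ (h : ℕ) = g := by
    intro i j h g heq
    rw [Option.some_inj, Sigma.mk.injEq] at heq
    obtain ⟨rfl, heq⟩ := heq
    exact ⟨rfl, congrArg Fin.val (eq_of_heq heq)⟩
  have hmixed : ∀ (v : V) (a : A), T.position A hA (.inl v) ≠ T.position A hA (.inr a) := by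
    intro v a heq
    obtain ⟨g, hg, hg0⟩ := T.position_inr A hA a
    by_cases hv : v = T.root
    · rw [hv, position_root, hg] at heq
      exact Option.some_ne_none _ heq.symm
    · obtain ⟨h, hh, hh'⟩ := T.position_inl A hA hv
      rw [hh, hg] at heq
      obtain ⟨h1, h2⟩ := hsome heq
      have := T.lt_size_of_fork A hA hv (h1 ▸ T.fork_legFoot A hA a)
      omega
  rintro (v | a) (w | b) heq
  · congr 1
    by_cases hv : v = T.root <;> by_cases hw : w = T.root
    · rw [hv, hw]
    · obtain ⟨h, hh, -⟩ := T.position_inl A hA hw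
      rw [hv, position_root, hh] at heq
      exact absurd heq.symm (Option.some_ne_none _)
    · obtain ⟨h, hh, -⟩ := T.position_inl A hA hv
      rw [hw, position_root, hh] at heq
      exact absurd heq (Option.some_ne_none _)
    · obtain ⟨h, hh, hh'⟩ := T.position_inl A hA hv
      obtain ⟨g, hg, hg'⟩ := T.position_inl A hA hw
      rw [hh, hg] at heq
      obtain ⟨h1, h2⟩ := hsome heq
      have hs := congrArg (T.legData A hA).size h1
      exact T.eq_of_foot_eq hv (by omega) (congrArg Subtype.val h1)
  · exact absurd heq (hmixed v b)
  · exact absurd heq.symm (hmixed w a)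
  · congr 1
    obtain ⟨h, hh, -⟩ := T.position_inr A hA a
    obtain ⟨g, hg, -⟩ := T.position_inr A hA b
    rw [hh, hg] at heq
    obtain ⟨h1, -⟩ := hsome heq
    have ha := T.depth_twin_add_one A hA hleaf a
    have hb := T.depth_twin_add_one A hA hleaf b
    have hs := congrArg (T.legData A hA).size h1
    exact Subtype.ext
      (T.eq_of_foot_eq (T.twin_ne_root hA a) (by omega) (congrArg Subtype.val h1))

theorem position_surjective : Function.Surjective (T.position A hA) := by
  have hsome : ∀ {i : T.Foot} {h g : Fin ((T.legData A hA).size i)}, (h : ℕ) = g →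
      (some ⟨i, h⟩ : Option (Σ u : T.Foot, Fin ((T.legData A hA).size u))) = some ⟨i, g⟩ :=
    fun h => by rw [Fin.ext h]
  rintro (_ | ⟨u, h⟩)
  · exact ⟨.inl T.root, T.position_root A hA⟩
  by_cases hf : (T.legData A hA).fork u ∧ (h : ℕ) = 0
  · obtain ⟨⟨a, ha, hau⟩, h0⟩ := hf
    refine ⟨.inr ⟨a, ha⟩, ?_⟩
    obtain ⟨g, hg, hg0⟩ := T.position_inr A hA ⟨a, ha⟩
    rw [hg]
    have hu : T.legFoot a (T.twin_ne_root hA ⟨a, ha⟩) = u := Subtype.ext hau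
    subst hu
    exact hsome (hg0.trans h0.symm)
  · have hlt := h.2
    have hle : (T.legData A hA).size u - h ≤ T.legDepth u := by
      by_cases hf' : (T.legData A hA).fork u
      · have := T.size_legData_of_fork A hA hf'
        have h0 : (h : ℕ) ≠ 0 := fun h0 => hf ⟨hf', h0⟩
        omega
      · have := T.size_legData_of_not_fork A hA hf'
        omega
    obtain ⟨v, hv, hvu, hd⟩ := T.exists_depth_eq u.2 (by omega) hle
    refine ⟨.inl v, ?_⟩
    obtain ⟨g, hg, hg'⟩ := T.position_inl A hA hv
    rw [hg]
    have hu : T.legFoot v hv = u := Subtype.ext hvu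
    subst hu
    exact hsome (by omega)

theorem parent_position_inl {v : V} (hv : v ≠ T.root) :
    (T.legData A hA).parent (T.position A hA (.inl v)) =
      T.position A hA (.inl (T.parent v)) := by
  obtain ⟨h, hh, hh'⟩ := T.position_inl A hA hv
  have hd := T.depth_eq v hv
  rw [hh]
  by_cases hp : T.parent v = T.root
  · rw [hp, position_root, LegData.parent_eq_none_iff]
    rw [hp, T.depth_root] at hd
    omega
  · obtain ⟨g, hg, hg'⟩ := T.position_inl A hA hp
    have hfoot : T.legFoot v hv = T.legFoot (T.parent v) hp :=
      Subtype.ext (T.foot_parent hp hv).symm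
    rw [hg, LegData.parent_eq_some_iff]
    have hs := congrArg (T.legData A hA).size hfoot
    refine ⟨hfoot, Or.inr ⟨fun hf => ?_, by omega⟩⟩
    have := T.lt_size_of_fork A hA hv hf.1
    omega

theorem parent_position_inr (hleaf : ∀ a ∈ A, ∀ v, v ≠ T.root → T.parent v ≠ a) (a : A) :
    (T.legData A hA).parent (T.position A hA (.inr a)) =
      T.position A hA (.inl (T.parent a)) := by
  obtain ⟨h, hh, hh'⟩ := T.position_inr A hA a
  have ha := T.twin_ne_root hA a
  have hd := T.depth_eq a ha
  have hd2 := hA a a.2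
  have hp : T.parent a ≠ T.root := T.ne_root_iff.2 (by omega)
  obtain ⟨g, hg, hg'⟩ := T.position_inl A hA hp
  have hfoot : T.legFoot a ha = T.legFoot (T.parent a) hp :=
    Subtype.ext (T.foot_parent hp ha).symm
  rw [hh, hg, LegData.parent_eq_some_iff]
  have := T.depth_twin_add_one A hA hleaf a
  have hs := congrArg (T.legData A hA).size hfoot
  exact ⟨hfoot, Or.inl ⟨T.fork_legFoot A hA a, hh', by omega⟩⟩

theorem nonempty_iso_tree (S : SimpleGraph V)
    (hS : ∀ v w, S.Adj v w ↔ (v ≠ T.root ∧ T.parent v = w) ∨ (w ≠ T.root ∧ T.parent w = v))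
    (hleaf : ∀ a ∈ A, ∀ v, v ≠ T.root → T.parent v ≠ a) :
    Nonempty (S.addTwins A ≃g (T.legData A hA).tree.graph) := by
  have hinj := T.position_injective A hA hleaf
  have hnone : ∀ x, T.position A hA x ≠ none ↔ x ≠ .inl T.root := fun x => by
    rw [← T.position_root A hA]
    exact hinj.ne_iff
  refine ⟨⟨Equiv.ofBijective _ ⟨hinj, T.position_surjective A hA⟩, fun {x y} => ?_⟩⟩
  change (T.position A hA x ≠ none ∧ (T.legData A hA).parent (T.position A hA x) =
    T.position A hA y) ∨ (T.position A hA y ≠ none ∧ (T.legData A hA).parent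
      (T.position A hA y) = T.position A hA x) ↔ _
  rw [hnone, hnone]
  have hinl : ∀ v : V, ∀ y : V ⊕ A, ((Sum.inl v : V ⊕ A) ≠ .inl T.root ∧
      (T.legData A hA).parent (T.position A hA (.inl v)) = T.position A hA y) ↔
        v ≠ T.root ∧ Sum.inl (T.parent v) = y := fun v y => by
    rw [Sum.inl_injective.ne_iff]
    refine and_congr_right fun hv => ?_
    rw [T.parent_position_inl A hA hv, hinj.eq_iff]
  have hinr : ∀ a : A, ∀ y : V ⊕ A, ((Sum.inr a : V ⊕ A) ≠ .inl T.root ∧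
      (T.legData A hA).parent (T.position A hA (.inr a)) = T.position A hA y) ↔
        Sum.inl (T.parent a) = y := fun a y => by
    rw [T.parent_position_inr A hA hleaf, hinj.eq_iff]
    exact and_iff_right Sum.inr_ne_inl
  have hne := T.twin_ne_root hA
  rcases x with v | a <;> rcases y with w | b
  · rw [hinl, hinl, Sum.inl_injective.eq_iff, Sum.inl_injective.eq_iff, ← hS]
    rfl
  · rw [hinl, hinr, Sum.inl_injective.eq_iff]
    change _ ↔ S.Adj v b
    rw [hS]
    simp only [Sum.inl_ne_inr, and_false, false_or]
    exact ⟨fun h => Or.inr ⟨hne b, h⟩, fun h => (h.resolve_left fun h => hleaf b b.2 v h.1 h.2).2⟩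
  · rw [hinl, hinr, Sum.inl_injective.eq_iff]
    change _ ↔ S.Adj a w
    rw [hS]
    simp only [Sum.inl_ne_inr, and_false, or_false]
    exact ⟨fun h => Or.inl ⟨hne a, h⟩, fun h => (h.resolve_right fun h => hleaf a a.2 w h.1 h.2).2⟩
  · rw [hinr, hinr]
    change _ ↔ False
    simp

end LegTree

/-! ### Reduction of 2-spiders to their legs, and the conclusion -/

namespace SimpleGraph

open Classical in
-- Two children and a parent would give a vertex other than the torso degree at least three.
theorem IsSpiderWithTorso.exists_legTree {V : Type*} [Fintype V] {S : SimpleGraph V} {t : V}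
    (hS : S.IsSpiderWithTorso t) : ∃ T : LegTree V, T.root = t ∧ T.depth = S.dist t ∧
      ∀ v w, S.Adj v w ↔ (v ≠ T.root ∧ T.parent v = w) ∨ (w ≠ T.root ∧ T.parent w = v) := by
  obtain ⟨par, hdist, hadj⟩ := hS.1.exists_parent t
  refine ⟨⟨t, par, S.dist t, S.dist_self, hdist, fun v w hv hw hvw hp => ?_⟩, rfl, rfl, hadj⟩
  by_contra hne
  refine hp ((hS.2 (par v)).1 ?_)
  have h1 := hdist v hv
  have h2 := hdist w hw
  rw [← hvw] at h2
  have h3 := hdist (par v) hp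
  have hsub : ({v, w, par (par v)} : Finset V) ⊆ S.neighborFinset (par v) := by
    intro x hx
    simp only [mem_insert, mem_singleton] at hx
    rw [mem_neighborFinset, hadj]
    rcases hx with rfl | rfl | rfl
    exacts [Or.inr ⟨hv, rfl⟩, Or.inr ⟨hw, hvw.symm⟩, Or.inl ⟨hp, rfl⟩]
  have hcard : #({v, w, par (par v)} : Finset V) = 3 := by
    refine card_eq_three.2 ⟨v, w, par (par v), hne, ?_, ?_, rfl⟩
    · intro h
      rw [← h] at h3
      omega
    · intro h
      rw [← h] at h3
      omega
  rw [← hcard]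
  exact card_le_card hsub

/-- Every 2-spider is isomorphic to the tree with certain legs. -/
theorem IsTwoSpider.exists_legData {V : Type*} {G : SimpleGraph V} (hG : G.IsTwoSpider) :
    ∃ (ι : Type) (_ : Fintype ι) (D : LegData ι), 3 ≤ Fintype.card ι ∧
      Nonempty (G ≃g D.tree.graph) := by
  classical
  obtain ⟨n, S, t, A, hS, hA, ⟨e⟩⟩ := hG
  obtain ⟨T, rfl, hdepth, hadj⟩ := hS.exists_legTree
  have hane : ∀ a ∈ A, a ≠ T.root := by
    rintro a ha rfl
    have h1 := (hA _ ha).1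
    have h2 := (hS.2 T.root).2 rfl
    rw [h1] at h2
    omega
  have hA2 : ∀ a ∈ A, 2 ≤ T.depth a := by
    intro a ha
    have h0 := T.ne_root_iff.1 (hane a ha)
    have h1 : T.depth a ≠ 1 := fun h => (hA a ha).2 (by rwa [hdepth, dist_eq_one_iff_adj] at h)
    omega
  have hleaf : ∀ a ∈ A, ∀ v, v ≠ T.root → T.parent v ≠ a := by
    rintro a ha v hv rfl
    have h1 := T.depth_eq v hv
    have h2 := T.depth_eq _ (hane _ ha)
    obtain ⟨x, hx⟩ := card_eq_one.1 ((S.card_neighborFinset_eq_degree _).trans (hA _ ha).1)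
    have hvx : v ∈ S.neighborFinset (T.parent v) := by
      rw [mem_neighborFinset, hadj]
      exact Or.inr ⟨hv, rfl⟩
    have hpx : T.parent (T.parent v) ∈ S.neighborFinset (T.parent v) := by
      rw [mem_neighborFinset, hadj]
      exact Or.inl ⟨hane _ ha, rfl⟩
    rw [hx, mem_singleton] at hvx hpx
    rw [hpx, ← hvx] at h2
    omega
  obtain ⟨e'⟩ := T.nonempty_iso_tree A hA2 S hadj hleaf
  refine ⟨T.Foot, inferInstance, T.legData A hA2, ?_, ⟨e.trans e'⟩⟩
  have h3 := (hS.2 T.root).2 rfl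
  rw [← card_neighborFinset_eq_degree] at h3
  rw [Fintype.card_subtype]
  refine h3.trans (card_le_card fun u hu => ?_)
  rw [mem_neighborFinset] at hu
  rw [mem_filter, hdepth, dist_eq_one_iff_adj]
  exact ⟨mem_univ u, hu⟩

theorem chromaticSymmetricFunction_eq_of_iso {V W : Type*} [Fintype V] [Fintype W]
    {G : SimpleGraph V} {H : SimpleGraph W} (e : G ≃g H) :
    G.chromaticSymmetricFunction = H.chromaticSymmetricFunction := by
  funext m
  unfold chromaticSymmetricFunction
  refine congrArg Nat.cast (Nat.card_congr
    { toFun := fun κ => ⟨κ.1.comp e.symm.toHom, ?_⟩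
      invFun := fun κ => ⟨κ.1.comp e.toHom, ?_⟩
      left_inv := fun κ => ?_
      right_inv := fun κ => ?_ })
  · refine Eq.trans ?_ κ.2
    exact e.symm.toEquiv.sum_comp fun v => Finsupp.single (κ.1 v) 1
  · refine Eq.trans ?_ κ.2
    exact e.toEquiv.sum_comp fun v => Finsupp.single (κ.1 v) 1
  · apply Subtype.ext
    apply RelHom.ext
    intro v
    exact congrArg κ.1 (e.symm_apply_apply v)
  · apply Subtype.ext
    apply RelHom.ext
    intro v
    exact congrArg κ.1 (e.apply_symm_apply v)

end SimpleGraph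

theorem LegData.nonempty_iso {ι κ : Type*} (D : LegData ι) (E : LegData κ) (e : ι ≃ κ)
    (he : ∀ i, E.size (e i) = D.size i ∧ (E.fork (e i) ↔ D.fork i)) :
    Nonempty (D.tree.graph ≃g E.tree.graph) := by
  obtain ⟨size, fork, hpos, hthree⟩ := D
  -- Substituting the fields makes the positions on leg `i` and on leg `e i` the same type, so no
  -- casts are needed.
  obtain rfl : size = fun i => E.size (e i) := funext fun i => (he i).1.symm
  obtain rfl : fork = fun i => E.fork (e i) := funext fun i => propext (he i).2.symm
  set D : LegData ι := ⟨fun i => E.size (e i), fun i => E.fork (e i), hpos, hthree⟩ with hD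
  let f : Option (Σ i, Fin (E.size (e i))) ≃ Option (Σ j, Fin (E.size j)) :=
    Equiv.optionCongr (Equiv.sigmaCongrLeft (β := fun j => Fin (E.size j)) e)
  have hf : ∀ i h, f (some ⟨i, h⟩) = some ⟨e i, h⟩ := fun i h => rfl
  have hparent : ∀ v, f (D.parent v) = E.parent (f v) := by
    rintro (_ | ⟨i, h⟩)
    · rfl
    · rw [hf]
      rcases hp : D.parent (some ⟨i, h⟩) with _ | ⟨j, l⟩
      · rw [LegData.parent_eq_none_iff] at hp
        exact ((E.parent_eq_none_iff _).2 hp).symm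
      · rw [LegData.parent_eq_some_iff] at hp
        rw [hf]
        exact ((E.parent_eq_some_iff _ _).2 ⟨congrArg e hp.1, hp.2⟩).symm
  refine ⟨⟨f, fun {v w} => ?_⟩⟩
  have hnone : ∀ v, f v ≠ none ↔ v ≠ none := fun v => f.injective.ne_iff (y := none)
  change (f v ≠ none ∧ E.parent (f v) = f w) ∨ (f w ≠ none ∧ E.parent (f w) = f v) ↔
    (v ≠ none ∧ D.parent v = w) ∨ (w ≠ none ∧ D.parent w = v)
  rw [hnone, hnone, ← hparent, ← hparent, f.injective.eq_iff, f.injective.eq_iff]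

theorem theorem2 {V₁ V₂ : Type*} [Fintype V₁] [Fintype V₂]
    (T₁ : SimpleGraph V₁) (T₂ : SimpleGraph V₂)
    (h₁ : T₁.IsTwoSpider) (h₂ : T₂.IsTwoSpider) (hne : IsEmpty (T₁ ≃g T₂)) :
    T₁.chromaticSymmetricFunction ≠ T₂.chromaticSymmetricFunction := by
  intro h
  obtain ⟨ι, _, D, hD, ⟨e₁⟩⟩ := h₁.exists_legData
  obtain ⟨κ, _, E, hE, ⟨e₂⟩⟩ := h₂.exists_legData
  rw [SimpleGraph.chromaticSymmetricFunction_eq_of_iso e₁,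
    SimpleGraph.chromaticSymmetricFunction_eq_of_iso e₂] at h
  obtain ⟨e, he⟩ := D.exists_equiv_of_chromaticSymmetricFunction_eq E hD hE h
  obtain ⟨f⟩ := D.nonempty_iso E e he
  exact hne.false ((e₁.trans f).trans e₂.symm)
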